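/- Consider the type I Toda field theory and the Toda lattice $$u_{n,xy}=F_n,\qquad u_{n,tt}=F_n,\qquad F_n=e^{u_{n-1}-u_n}-e^{u_n-u_{n+1}},$$ on an infinite chain ($n\in\mathbb Z$), on the semi-infinite chains ($n\ge 1$) of the series $A,B,C,D$, where the equations at the left end are replaced by * $A$: $F_1=-e^{u_1-u_2}$; * $B$: $F_1=e^{-u_1}-e^{u_1-u_2}$; * $C$: $F_1=2e^{-2u_1}-e^{u_1-u_2}$; * $D$: $F_1=e^{-u_1-u_2}-e^{u_1-u_2}$, $F_2=e^{-u_1-u_2}+e^{u_1-u_2}-e^{u_2-u_3}$, and on the finite chains $A_N,B_N,C_N,D_N$ with sites $1\le n\le N$, $N\ge 2$, obtained from the semi-infinite ones by cutting after site $N$, i.e. omitting the term $e^{u_N-u_{N+1}}$ from $F_N$ (so that $F_N=e^{u_{N-1}-u_N}$ when the equation at site $N$ is not modified by the left end). A Lie point symmetry of a field theory is a smooth vector field $\xi\,\partial_x+\eta\,\partial_y+\sum_n\varphi_n\,\partial_{u_n}$ (of a lattice: $\tau\,\partial_t+\sum_n\varphi_n\,\partial_{u_n}$), with coefficients depending on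 $x,y$ (resp. $t$) and all the $u_k$, whose second prolongation annihilates all the equations on their solution set. The coefficients are defined on a box $x\in I$, $y\in J$ (resp. $t\in I$), $u_n\in U_n$, with nonempty open intervals $I,J,U_n\subseteq\mathbb R$ such that $0\in U_n$ unless $1\le n\le N$, and vector fields are compared on this box. On infinite chains, coefficients are functions of sequences $(u_k)$ with finitely many nonzero entries, smooth in any finite number of variables; the jets $u_x,u_y,u_{xx},u_{yy}$ (resp. $u_t$) also have finitely many nonzero entries; and in the prolongation the series $\sum_k \frac{\partial g}{\partial u_k}F_k$ is collected with respect to the exponentials occurring in the $F_k$ and is required to converge. **(1) Infinite theory.** For arbitrary smooth functions $\xi(x),\eta(y),\beta(x),\gamma(y)$ and constants $c,p,d,a,b$, the vector fields $$\xi\,\partial_x+\eta\,\partial_y+(\xi'+\eta')\sum_n n\,\partial_{u_n}+(\beta+\gamma)\sum_n\partial_{u_n}+c\Big(\sum_m u_m\Big)\sum_n\partial_{u_n}\qquad(*)$$ $$(p+dt)\,\partial_t+2d\sum_n n\,\partial_{u_n}+(a+bt)\sum_n\partial_{u_n}+c\Big(\sum_m u_m\Big)\sum_n\partial_{u_n}\qquad(**)$$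 are Lie point symmetries of the infinite Toda field theory and of the infinite Toda lattice, respectively. **(2) The finite symmetries are inherited.** Every Lie point symmetry of a finite $A_N,B_N,C_N,D_N$ Toda field theory (lattice) is the reduction of a field $(*)$ (resp. $(**)$) to $1\le n\le N$, that is, $u_k=0$ is put and $\partial_{u_k}$ omitted for all $k$ outside this range. More precisely, the Lie point symmetries are exactly the reductions of those $(*)$, $(**)$ with * $A_N$: no further condition; * $B_N$: $c=0$, $\beta+\gamma=0$ (lattice: $a=b=c=0$); * $C_N$: $c=0$, $\beta+\gamma=-\tfrac12(\xi'+\eta')$ (lattice: $a=-d$, $b=c=0$); * $D_N$: $c=0$, $\beta+\gamma=-(\xi'+\eta')$ (lattice: $a=-2d$, $b=c=0$). **(3) They coincide with the semi-infinite symmetries.** For each of the four series, reduction to $1\le n\le N$ is a bijection from the Lie point symmetries of the semi-infinite Toda field theory onto those of the finite one, and from the Lie point symmetries of the semi-infinite Toda lattice onto those of the finite one. -/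

import Mathlib

open scoped ContDiff

noncomputable section

namespace Toda

/-- The four classical Cartan series. -/
inductive Series where
  | A | B | C | D

/-- The chains: the sites are all integers, the integers `n ≥ 1`, or `1 ≤ n ≤ N`. -/
inductive Chain where
  | infinite
  | semiInfinite (T : Series)
  | finite (T : Series) (N : ℕ)

/-- The set of sites of a chain. -/
def Chain.sites : Chain → Set ℤ
  | .infinite => Set.univ
  | .semiInfinite _ => Set.Ici 1
  | .finite _ N => Set.Icc 1 (N : ℤ)

/-- The exponent `u_m - u_{m+1}`, as a vector of coefficients. -/
def bond (m : ℤ) : ℤ →₀ ℝ := Finsupp.single m 1 - Finsupp.single (m + 1) 1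

/-- The additional exponent at the left end of the chain: none for `A`, `-u_1` for `B`,
`-2 u_1` for `C`, `-u_1 - u_2` for `D`. -/
def endRoot : Series → (ℤ →₀ ℝ)
  | .A => 0
  | .B => -Finsupp.single 1 1
  | .C => -Finsupp.single 1 2
  | .D => -Finsupp.single 1 1 - Finsupp.single 2 1

/-- The exponents (root vectors) of the theory, indexed by `m : ℤ`. The bond `m` joins the sites
`m` and `m + 1`; the index `0` of a chain with a left end carries the additional exponent of the
series; unused indices carry the zero vector. -/
def Chain.root : Chain → ℤ → (ℤ →₀ ℝ)
  | .infinite, m => bond m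
  | .semiInfinite T, m => if 1 ≤ m then bond m else if m = 0 then endRoot T else 0
  | .finite T N, m =>
      if 1 ≤ m ∧ m + 1 ≤ (N : ℤ) then bond m else if m = 0 then endRoot T else 0

/-- Values of the fields `u_n`. For a finite chain this is `ℝ^N`; for an infinite chain only
finitely many `u_n` differ from `0`, so that a formal series such as `∑ u_m` is a function. -/
abbrev Chain.Config (c : Chain) : Type := c.sites →₀ ℝ

/-- The root vectors as vectors over the sites. -/
def Chain.rootOn (c : Chain) (m : ℤ) : c.Config :=
  (c.root m).subtypeDomain (fun n => n ∈ c.sites)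

/-- The exponential `exp (α_m · u)`. -/
def Chain.expo (c : Chain) (m : ℤ) (u : c.Config) : ℝ :=
  Real.exp ((c.rootOn m).sum fun n a => a * u n)

/-- The right-hand side `F_n(u) = - ∑_m (α_m)_n exp (α_m · u)` of the equations
`u_{n,xy} = F_n(u)` (field theory) and `u_{n,tt} = F_n(u)` (lattice). At a site away from the ends
it is `exp (u_{n-1} - u_n) - exp (u_n - u_{n+1})`. -/
def Chain.force (c : Chain) (n : c.sites) (u : c.Config) : ℝ :=
  ∑ᶠ m : ℤ, -(c.rootOn m n) * c.expo m u

/-- The `m`-th term of `∑_k (∂G/∂u_k) F_k(u)` when this (formal) double series is collected with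
respect to the exponentials: `exp (α_m · u)` times the derivative of `G` along `-α_m`. -/
def Chain.forceTerm (c : Chain) (G : c.Config → ℝ) (u : c.Config) (m : ℤ) : ℝ :=
  c.expo m u * deriv (fun s : ℝ => G (u - s • c.rootOn m)) 0

/-- `∑_k (∂G/∂u_k) F_k(u)`, collected with respect to the exponentials; for a finite chain this is
the ordinary finite sum. -/
def Chain.forceDeriv (c : Chain) (G : c.Config → ℝ) (u : c.Config) : ℝ :=
  ∑' m : ℤ, c.forceTerm G u m

/-- Every coordinate `u_n` lies in the prescribed set `U n`. -/
def Chain.InBox (c : Chain) (U : ℤ → Set ℝ) (u : c.Config) : Prop :=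
  ∀ n : c.sites, u n ∈ U n

/-- The configuration with coordinates `a` on the finite set `S` of sites and `0` elsewhere. -/
def Chain.ofCoords (c : Chain) (S : Finset c.sites) (a : S → ℝ) : c.Config :=
  ∑ n : S, Finsupp.single n.1 (a n)

/-- Extension of a configuration by `0` to a longer chain. -/
def extend {c c' : Chain} (h : c.sites ⊆ c'.sites) (u : c.Config) : c'.Config :=
  Finsupp.mapDomain (Set.inclusion h) u

lemma finite_subset_semiInfinite (T : Series) (N : ℕ) :
    (Chain.finite T N).sites ⊆ (Chain.semiInfinite T).sites := fun _ h => h.1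

lemma finite_subset_infinite (T : Series) (N : ℕ) :
    (Chain.finite T N).sites ⊆ Chain.infinite.sites := fun _ _ => trivial

/-- Nonempty open intervals of the real line, bounded or not. -/
def IsOpenInterval (I : Set ℝ) : Prop := IsOpen I ∧ I.OrdConnected ∧ I.Nonempty

/-! ### Field theories -/

/-- Vector fields `ξ ∂_x + η ∂_y + ∑_n φ_n ∂_{u_n}` with coefficients depending on `x`, `y` and
all the fields. -/
structure FieldVF (c : Chain) where
  ξ : ℝ → ℝ → c.Config → ℝ
  η : ℝ → ℝ → c.Config → ℝ
  φ : c.sites → ℝ → ℝ → c.Config → ℝ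

/-- Smoothness in `x`, `y` and any finite number of the fields. -/
def FieldSmooth (c : Chain) (I J : Set ℝ) (U : ℤ → Set ℝ) (g : ℝ → ℝ → c.Config → ℝ) : Prop :=
  ∀ S : Finset c.sites,
    ContDiffOn ℝ ∞ (fun z : ℝ × ℝ × (S → ℝ) => g z.1 z.2.1 (c.ofCoords S z.2.2))
      {z | z.1 ∈ I ∧ z.2.1 ∈ J ∧ c.InBox U (c.ofCoords S z.2.2)}

/-- Total derivative `D_x g = g_x + ∑_k u_{k,x} ∂g/∂u_k`, with `p = u_x`. -/
def totalX {c : Chain} (g : ℝ → ℝ → c.Config → ℝ) (x y : ℝ) (u p : c.Config) : ℝ :=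
  deriv (fun s : ℝ => g (x + s) y (u + s • p)) 0

/-- Total derivative `D_y g = g_y + ∑_k u_{k,y} ∂g/∂u_k`, with `q = u_y`. -/
def totalY {c : Chain} (g : ℝ → ℝ → c.Config → ℝ) (x y : ℝ) (u q : c.Config) : ℝ :=
  deriv (fun t : ℝ => g x (y + t) (u + t • q)) 0

/-- Total derivative `D_x D_y g` on the solution set: with `p = u_x`, `q = u_y`, the first summand
is `g_{xy} + ∑_k q_k g_{x u_k} + ∑_k p_k g_{y u_k} + ∑_{k,l} p_k q_l g_{u_k u_l}`, the second one
is `∑_k u_{k,xy} g_{u_k}` with `u_{k,xy} = F_k(u)`. -/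
def totalXY {c : Chain} (g : ℝ → ℝ → c.Config → ℝ) (x y : ℝ) (u p q : c.Config) : ℝ :=
  deriv (fun s : ℝ => deriv (fun t : ℝ => g (x + s) (y + t) (u + s • p + t • q)) 0) 0
    + c.forceDeriv (g x y) u

/-- The coefficient of `∂/∂u_{n,xy}` in the second prolongation of `v`, on the solution set, at the
jet `p = u_x`, `q = u_y`, `r = u_{xx}`, `s = u_{yy}`, `u_{xy} = F(u)`. -/
def FieldVF.prolongXY {c : Chain} (v : FieldVF c) (n : c.sites) (x y : ℝ)
    (u p q r s : c.Config) : ℝ :=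
  totalXY (v.φ n) x y u p q - totalXY v.ξ x y u p q * p n - totalXY v.η x y u p q * q n
    - totalX v.ξ x y u p * c.force n u - totalY v.ξ x y u q * r n
    - totalX v.η x y u p * s n - totalY v.η x y u q * c.force n u

/-- The derivative `∑_l φ_l ∂F_n/∂u_l` of `F_n` along `v`. -/
def FieldVF.derivForce {c : Chain} (v : FieldVF c) (n : c.sites) (x y : ℝ) (u : c.Config) : ℝ :=
  ∑ᶠ l : c.sites, v.φ l x y u * deriv (fun s : ℝ => c.force n (u + Finsupp.single l s)) 0

/-- `v` is (the generator of) a Lie point symmetry of `u_{n,xy} = F_n(u)`: its coefficients are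
smooth for `x ∈ I`, `y ∈ J`, `u_n ∈ U n`, the series in its prolongation converge, and the
prolongation annihilates all the equations on their solution set. -/
structure FieldVF.IsSymmetry {c : Chain} (I J : Set ℝ) (U : ℤ → Set ℝ) (v : FieldVF c) : Prop where
  smooth_ξ : FieldSmooth c I J U v.ξ
  smooth_η : FieldSmooth c I J U v.η
  smooth_φ : ∀ n, FieldSmooth c I J U (v.φ n)
  summable_ξ : ∀ x ∈ I, ∀ y ∈ J, ∀ u, c.InBox U u → Summable (c.forceTerm (v.ξ x y) u)
  summable_η : ∀ x ∈ I, ∀ y ∈ J, ∀ u, c.InBox U u → Summable (c.forceTerm (v.η x y) u)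
  summable_φ : ∀ n, ∀ x ∈ I, ∀ y ∈ J, ∀ u, c.InBox U u → Summable (c.forceTerm (v.φ n x y) u)
  annihilates : ∀ x ∈ I, ∀ y ∈ J, ∀ u, c.InBox U u → ∀ (p q r s : c.Config) (n : c.sites),
    v.prolongXY n x y u p q r s = v.derivForce n x y u

/-- Equality of vector fields on the domain `x ∈ I`, `y ∈ J`, `u_n ∈ U n`. -/
def FieldVF.EqOn {c : Chain} (I J : Set ℝ) (U : ℤ → Set ℝ) (v w : FieldVF c) : Prop :=
  ∀ x ∈ I, ∀ y ∈ J, ∀ u, c.InBox U u →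
    v.ξ x y u = w.ξ x y u ∧ v.η x y u = w.η x y u ∧ ∀ n, v.φ n x y u = w.φ n x y u

/-- Reduction to a shorter chain: put `u_k = 0` at the sites that are removed, and omit the
corresponding `∂_{u_k}`. -/
def FieldVF.reduce {c c' : Chain} (h : c.sites ⊆ c'.sites) (v : FieldVF c') : FieldVF c where
  ξ x y u := v.ξ x y (extend h u)
  η x y u := v.η x y (extend h u)
  φ n x y u := v.φ (Set.inclusion h n) x y (extend h u)

/-- The parameters of `X(ξ, η) + V(β, γ) + c Z`. -/
structure FieldParams where
  ξ : ℝ → ℝ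
  η : ℝ → ℝ
  β : ℝ → ℝ
  γ : ℝ → ℝ
  c : ℝ

/-- The functions are smooth on their intervals. -/
def FieldParams.Smooth (P : FieldParams) (I J : Set ℝ) : Prop :=
  ContDiffOn ℝ ∞ P.ξ I ∧ ContDiffOn ℝ ∞ P.η J ∧ ContDiffOn ℝ ∞ P.β I ∧ ContDiffOn ℝ ∞ P.γ J

/-- The general element `X + V + c Z` of the algebra of the infinite theory, where
`X = ξ(x) ∂_x + η(y) ∂_y + (ξ' + η') ∑ n ∂_{u_n}`, `V = (β(x) + γ(y)) ∑ ∂_{u_n}`,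
`Z = (∑ u_m) ∑ ∂_{u_n}`. -/
def FieldParams.generator (P : FieldParams) : FieldVF Chain.infinite where
  ξ x _ _ := P.ξ x
  η _ y _ := P.η y
  φ n x y u := (deriv P.ξ x + deriv P.η y) * ((n : ℤ) : ℝ) + (P.β x + P.γ y)
    + P.c * u.sum fun _ a => a

/-- The part of the algebra that survives at the left end of the chain. -/
def FieldParams.Survives (P : FieldParams) (I J : Set ℝ) : Series → Prop
  | .A => True
  | .B => P.c = 0 ∧ ∀ x ∈ I, ∀ y ∈ J, P.β x + P.γ y = 0
  | .C => P.c = 0 ∧ ∀ x ∈ I, ∀ y ∈ J, P.β x + P.γ y = -(1 / 2 : ℝ) * (deriv P.ξ x + deriv P.η y)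
  | .D => P.c = 0 ∧ ∀ x ∈ I, ∀ y ∈ J, P.β x + P.γ y = -(deriv P.ξ x + deriv P.η y)

/-! ### Lattices -/

/-- Vector fields `τ ∂_t + ∑_n φ_n ∂_{u_n}`. -/
structure LatticeVF (c : Chain) where
  τ : ℝ → c.Config → ℝ
  φ : c.sites → ℝ → c.Config → ℝ

/-- Smoothness in `t` and any finite number of the fields. -/
def LatticeSmooth (c : Chain) (I : Set ℝ) (U : ℤ → Set ℝ) (g : ℝ → c.Config → ℝ) : Prop :=
  ∀ S : Finset c.sites,
    ContDiffOn ℝ ∞ (fun z : ℝ × (S → ℝ) => g z.1 (c.ofCoords S z.2))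
      {z | z.1 ∈ I ∧ c.InBox U (c.ofCoords S z.2)}

/-- Total derivative `D_t g = g_t + ∑_k u_{k,t} ∂g/∂u_k`, with `p = u_t`. -/
def totalT {c : Chain} (g : ℝ → c.Config → ℝ) (t : ℝ) (u p : c.Config) : ℝ :=
  deriv (fun s : ℝ => g (t + s) (u + s • p)) 0

/-- Total derivative `D_t D_t g` on the solution set: with `p = u_t`, the first summand is
`g_{tt} + 2 ∑_k p_k g_{t u_k} + ∑_{k,l} p_k p_l g_{u_k u_l}`, the second one is
`∑_k u_{k,tt} g_{u_k}` with `u_{k,tt} = F_k(u)`. -/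
def totalTT {c : Chain} (g : ℝ → c.Config → ℝ) (t : ℝ) (u p : c.Config) : ℝ :=
  iteratedDeriv 2 (fun s : ℝ => g (t + s) (u + s • p)) 0 + c.forceDeriv (g t) u

/-- The coefficient of `∂/∂u_{n,tt}` in the second prolongation of `v`, on the solution set. -/
def LatticeVF.prolongTT {c : Chain} (v : LatticeVF c) (n : c.sites) (t : ℝ)
    (u p : c.Config) : ℝ :=
  totalTT (v.φ n) t u p - totalTT v.τ t u p * p n - 2 * totalT v.τ t u p * c.force n u

/-- The derivative `∑_l φ_l ∂F_n/∂u_l` of `F_n` along `v`. -/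
def LatticeVF.derivForce {c : Chain} (v : LatticeVF c) (n : c.sites) (t : ℝ) (u : c.Config) : ℝ :=
  ∑ᶠ l : c.sites, v.φ l t u * deriv (fun s : ℝ => c.force n (u + Finsupp.single l s)) 0

/-- `v` is (the generator of) a Lie point symmetry of `u_{n,tt} = F_n(u)`, for `t ∈ I` and
`u_n ∈ U n`. -/
structure LatticeVF.IsSymmetry {c : Chain} (I : Set ℝ) (U : ℤ → Set ℝ) (v : LatticeVF c) :
    Prop where
  smooth_τ : LatticeSmooth c I U v.τ
  smooth_φ : ∀ n, LatticeSmooth c I U (v.φ n)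
  summable_τ : ∀ t ∈ I, ∀ u, c.InBox U u → Summable (c.forceTerm (v.τ t) u)
  summable_φ : ∀ n, ∀ t ∈ I, ∀ u, c.InBox U u → Summable (c.forceTerm (v.φ n t) u)
  annihilates : ∀ t ∈ I, ∀ u, c.InBox U u → ∀ (p : c.Config) (n : c.sites),
    v.prolongTT n t u p = v.derivForce n t u

/-- Equality of vector fields on the domain `t ∈ I`, `u_n ∈ U n`. -/
def LatticeVF.EqOn {c : Chain} (I : Set ℝ) (U : ℤ → Set ℝ) (v w : LatticeVF c) : Prop :=
  ∀ t ∈ I, ∀ u, c.InBox U u → v.τ t u = w.τ t u ∧ ∀ n, v.φ n t u = w.φ n t u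

/-- Reduction to a shorter chain, as for field theories. -/
def LatticeVF.reduce {c c' : Chain} (h : c.sites ⊆ c'.sites) (v : LatticeVF c') :
    LatticeVF c where
  τ t u := v.τ t (extend h u)
  φ n t u := v.φ (Set.inclusion h n) t (extend h u)

/-- The coefficients of `p P + d D + a U + b W + c Z`. -/
structure LatticeParams where
  p : ℝ
  d : ℝ
  a : ℝ
  b : ℝ
  c : ℝ

/-- The general element `p P + d D + a U + b W + c Z` of the algebra of the infinite lattice, where
`P = ∂_t`, `D = t ∂_t + 2 ∑ n ∂_{u_n}`, `U = ∑ ∂_{u_n}`, `W = t ∑ ∂_{u_n}`,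
`Z = (∑ u_m) ∑ ∂_{u_n}`. -/
def LatticeParams.generator (P : LatticeParams) : LatticeVF Chain.infinite where
  τ t _ := P.p + P.d * t
  φ n t u := 2 * P.d * ((n : ℤ) : ℝ) + P.a + P.b * t + P.c * u.sum fun _ a => a

/-- The part of the algebra that survives at the left end of the chain. -/
def LatticeParams.Survives (P : LatticeParams) : Series → Prop
  | .A => True
  | .B => P.a = 0 ∧ P.b = 0 ∧ P.c = 0
  | .C => P.a = -P.d ∧ P.b = 0 ∧ P.c = 0
  | .D => P.a = -2 * P.d ∧ P.b = 0 ∧ P.c = 0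

end Toda

end

/-! The finite chain and the semi-infinite chain of one series have the same left end, and a cut on
the right adds no exponential. Both satisfy `Chain.IsLeftEnded`, and one argument shows that their
symmetries have the same normal form `P.on c`, where `P` satisfies the conditions `Survives` of the
series. Since `P.on` commutes with reduction, inheritance and bijectivity follow by comparing
parameters.

For the normal form, the determining equations are first split by their dependence on the jets. In
the field theory this gives `ξ = ξ(x)`, `η = η(y)` and `φ_n = L_n(u) + f_n(x, y)` with constant
linear functionals `L_n`. In the lattice, `τ = θ(t)`, and `φ_n` is affine in `u` with linear part
`L_n(u) + θ'(t) u_n / 2`.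

What remains relates exponentials `exp (α_m · u)` with affine coefficients. Moving `u` along a step
function changes just one bond exponential and, possibly, the one at the left end, so the
coefficients can be separated one root at a time (`coeff_root_eq`), even when the series is
infinite. With `σ = ξ' + η'` (lattice: `σ = 2θ'`) the result is `L_n(α_m) = (α_m)_n (σ + α_m ·
φ(u))` for every root.

The left side does not depend on `u`, so along a bond the functionals at its two sites agree. The
two equations of the bond have opposite signs, so `L_n` takes equal values at neighbouring sites and
`f_{n+1} = f_n + σ`. By induction `φ_n = f_1 + σ (n - 1) + b ∑ u_m`, and the additional root fixes
`f_1` and forces `b = 0` except in series `A` (`Chain.IsLeftEnded.solve`). Conversely, such fields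
satisfy `α_m · φ = -σ` on every nonzero root, so they multiply all exponentials by the same factor
and are symmetries (`on_isSymmetry`).

On the semi-infinite chain the configurations are finitely supported sequences. Calculus is
therefore done along finite-dimensional affine slices, with line derivatives in place of Fréchet
derivatives. -/

namespace Toda

open Filter Topology

/-! ### Differential calculus along finite-dimensional slices -/

section Slice

variable {X : Type*} [AddCommGroup X] [Module ℝ X]

/-- `g` is smooth near `z` along all finite-dimensional affine slices through `z`. -/
def SliceSmoothAt (g : X → ℝ) (z : X) : Prop :=
  ∀ (V : Type) [NormedAddCommGroup V] [NormedSpace ℝ V] [FiniteDimensional ℝ V] (A : V →ₗ[ℝ] X),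
    ContDiffAt ℝ ∞ (fun a => g (z + A a)) 0

/-- `D` is open along all finite-dimensional affine slices. -/
def SliceOpen (D : Set X) : Prop :=
  ∀ z ∈ D, ∀ (V : Type) [NormedAddCommGroup V] [NormedSpace ℝ V] [FiniteDimensional ℝ V]
    (A : V →ₗ[ℝ] X), ∀ᶠ a in 𝓝 (0 : V), z + A a ∈ D

lemma SliceOpen.eventually_line {D : Set X} (hD : SliceOpen D) {z : X} (hz : z ∈ D) (v : X) :
    ∀ᶠ s : ℝ in 𝓝 0, z + s • v ∈ D :=
  hD z hz ℝ (LinearMap.toSpanSingleton ℝ X v)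

lemma lineDeriv_congr_on {D : Set X} (hD : SliceOpen D) {z : X} (hz : z ∈ D) {g h : X → ℝ}
    (hgh : Set.EqOn g h D) (v : X) : lineDeriv ℝ g z v = lineDeriv ℝ h z v := by
  refine Filter.EventuallyEq.deriv_eq ?_
  filter_upwards [hD.eventually_line hz v] with s hs using hgh hs

lemma SliceSmoothAt.add {g h : X → ℝ} {z : X} (hg : SliceSmoothAt g z) (hh : SliceSmoothAt h z) :
    SliceSmoothAt (fun w => g w + h w) z := fun V _ _ _ A => (hg V A).add (hh V A)

lemma SliceSmoothAt.sub {g h : X → ℝ} {z : X} (hg : SliceSmoothAt g z) (hh : SliceSmoothAt h z) :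
    SliceSmoothAt (fun w => g w - h w) z := fun V _ _ _ A => (hg V A).sub (hh V A)

lemma SliceSmoothAt.mul {g h : X → ℝ} {z : X} (hg : SliceSmoothAt g z) (hh : SliceSmoothAt h z) :
    SliceSmoothAt (fun w => g w * h w) z := fun V _ _ _ A => (hg V A).mul (hh V A)

lemma sliceSmoothAt_const (a : ℝ) (z : X) : SliceSmoothAt (fun _ => a) z :=
  fun _ _ _ _ _ => contDiffAt_const

lemma sliceSmoothAt_linear (l : X →ₗ[ℝ] ℝ) (z : X) : SliceSmoothAt (fun w => l w) z := by
  intro V _ _ _ A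
  have h : ContDiff ℝ ∞ (fun a => l z + (LinearMap.toContinuousLinearMap (l ∘ₗ A)) a) :=
    contDiff_const.add (ContinuousLinearMap.contDiff _)
  simpa using h.contDiffAt

lemma SliceSmoothAt.lineDifferentiableAt {g : X → ℝ} {z : X} (hg : SliceSmoothAt g z) (v : X) :
    LineDifferentiableAt ℝ g z v :=
  (hg ℝ (LinearMap.toSpanSingleton ℝ X v)).differentiableAt (by simp)

lemma SliceSmoothAt.lineDeriv_map {g : X → ℝ} {z : X} (hg : SliceSmoothAt g z)
    {V : Type} [NormedAddCommGroup V] [NormedSpace ℝ V] [FiniteDimensional ℝ V]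
    (A : V →ₗ[ℝ] X) (a : V) :
    lineDeriv ℝ g z (A a) = fderiv ℝ (fun a => g (z + A a)) 0 a := by
  have h := ((hg V A).differentiableAt (by simp)).lineDeriv_eq_fderiv (v := a)
  rw [← h]
  simp [lineDeriv]

lemma SliceSmoothAt.lineDeriv_add {g : X → ℝ} {z : X} (hg : SliceSmoothAt g z) (v w : X) :
    lineDeriv ℝ g z (v + w) = lineDeriv ℝ g z v + lineDeriv ℝ g z w := by
  let A : ℝ × ℝ →ₗ[ℝ] X :=
    (LinearMap.toSpanSingleton ℝ X v).coprod (LinearMap.toSpanSingleton ℝ X w)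
  have h1 : A (1, 0) = v := by simp [A]
  have h2 : A (0, 1) = w := by simp [A]
  rw [← h1, ← h2, ← map_add, hg.lineDeriv_map, hg.lineDeriv_map, hg.lineDeriv_map, map_add]

/-- The line derivative as a linear map in the direction. -/
noncomputable def SliceSmoothAt.lineDerivₗ {g : X → ℝ} {z : X} (hg : SliceSmoothAt g z) : X →ₗ[ℝ] ℝ where
  toFun v := lineDeriv ℝ g z v
  map_add' := hg.lineDeriv_add
  map_smul' _ _ := lineDeriv_smul

/-- With the direction `v` as one more parameter, the line derivative becomes a partial derivative
on `V × ℝ`. Smoothness of `lineDeriv` is thus inherited from a slice one dimension larger. -/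
lemma SliceSmoothAt.lineDeriv_eq_eventually {g : X → ℝ} {z : X} (hg : SliceSmoothAt g z) (v : X)
    {V : Type} [NormedAddCommGroup V] [NormedSpace ℝ V] [FiniteDimensional ℝ V]
    (A : V →ₗ[ℝ] X) :
    (fun a => lineDeriv ℝ g (z + A a) v) =ᶠ[𝓝 0] fun a =>
      fderiv ℝ (fun b : V × ℝ => g (z + A.coprod (LinearMap.toSpanSingleton ℝ X v) b)) (a, 0)
        (0, 1) := by
  set H := fun b : V × ℝ => g (z + A.coprod (LinearMap.toSpanSingleton ℝ X v) b) with hH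
  have hc : ContDiffAt ℝ 1 H (0, 0) :=
    (hg (V × ℝ) (A.coprod (LinearMap.toSpanSingleton ℝ X v))).of_le (by exact_mod_cast le_top)
  have he : ∀ᶠ b in 𝓝 ((0, 0) : V × ℝ), ContDiffAt ℝ 1 H b := hc.eventually (by simp)
  have ht : Tendsto (fun a : V => (a, (0 : ℝ))) (𝓝 0) (𝓝 (0, 0)) :=
    (Continuous.prodMk continuous_id continuous_const).tendsto' _ _ rfl
  filter_upwards [ht.eventually he] with a ha
  have hd : HasFDerivAt H (fderiv ℝ H (a, 0)) (a, 0) :=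
    (ha.differentiableAt (by simp)).hasFDerivAt
  have h2 := (hd.hasLineDerivAt (0, 1)).lineDeriv
  rw [← h2]
  simp [lineDeriv, hH, add_assoc]

lemma SliceSmoothAt.lineDeriv {g : X → ℝ} {z : X} (hg : SliceSmoothAt g z) (v : X) :
    SliceSmoothAt (fun w => lineDeriv ℝ g w v) z := by
  intro V _ _ _ A
  refine ContDiffAt.congr_of_eventuallyEq ?_ (hg.lineDeriv_eq_eventually v A)
  have hc := hg (V × ℝ) (A.coprod (LinearMap.toSpanSingleton ℝ X v))
  have h1 := hc.fderiv_right (m := ∞) (by simp)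
  have h2 : ContDiffAt ℝ ∞ (fun a : V => (a, (0 : ℝ))) 0 :=
    contDiffAt_id.prodMk contDiffAt_const
  have h3 : ContDiffAt ℝ ∞ (fun a : V => _root_.fderiv ℝ (fun b : V × ℝ =>
    g (z + A.coprod (LinearMap.toSpanSingleton ℝ X v) b)) (a, 0)) 0 :=
    ContDiffAt.comp (x := (0 : V)) (f := fun a : V => (a, (0 : ℝ))) (g := _root_.fderiv ℝ _) h1 h2
  exact h3.clm_apply contDiffAt_const

/-- Symmetry of the second derivative of the pullback of `g` to the plane with coordinates along `v`
and `w`. -/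
lemma SliceSmoothAt.lineDeriv_comm {g : X → ℝ} {z : X} (hg : SliceSmoothAt g z) (v w : X) :
    _root_.lineDeriv ℝ (fun x => _root_.lineDeriv ℝ g x v) z w =
      _root_.lineDeriv ℝ (fun x => _root_.lineDeriv ℝ g x w) z v := by
  let A : ℝ × ℝ →ₗ[ℝ] X :=
    (LinearMap.toSpanSingleton ℝ X v).coprod (LinearMap.toSpanSingleton ℝ X w)
  have h1 : A (1, 0) = v := by simp [A]
  have h2 : A (0, 1) = w := by simp [A]
  set H := fun b : ℝ × ℝ => g (z + A b) with hH
  have hc : ContDiffAt ℝ ∞ H 0 := hg _ A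
  have hsymm : IsSymmSndFDerivAt ℝ H 0 := hc.isSymmSndFDerivAt (by
    rw [minSmoothness_of_isRCLikeNormedField]
    exact WithTop.coe_le_coe.2 (le_top (a := (2 : ℕ∞))))
  have hfd : DifferentiableAt ℝ (fderiv ℝ H) 0 :=
    (hc.fderiv_right (m := ∞) (by simp)).differentiableAt (by simp)
  have he : ∀ᶠ b in 𝓝 (0 : ℝ × ℝ), ContDiffAt ℝ 1 H b :=
    (hc.of_le (by exact_mod_cast le_top)).eventually (by simp)
  have key : ∀ a b : ℝ × ℝ, _root_.lineDeriv ℝ (fun x => _root_.lineDeriv ℝ g x (A a)) z (A b) =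
      fderiv ℝ (fderiv ℝ H) 0 b a := by
    intro a b
    have e1 : (fun s : ℝ => _root_.lineDeriv ℝ g (z + s • A b) (A a)) =ᶠ[𝓝 0]
        fun s : ℝ => fderiv ℝ H (s • b) a := by
      have ht : Tendsto (fun s : ℝ => s • b) (𝓝 0) (𝓝 0) :=
        Continuous.tendsto' (by fun_prop) _ _ (by simp)
      filter_upwards [ht.eventually he] with s hs
      have h3 := ((hs.differentiableAt (by simp)).hasFDerivAt.hasLineDerivAt a).lineDeriv
      rw [← h3]
      simp [_root_.lineDeriv, hH, add_assoc]
    have e2 := hfd.hasFDerivAt.hasLineDerivAt b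
    have e3 : HasDerivAt (fun s : ℝ => fderiv ℝ H (0 + s • b) a)
        (fderiv ℝ (fderiv ℝ H) 0 b a) 0 :=
      HasDerivAt.clm_apply (u := fun _ => a) (u' := 0) e2 (hasDerivAt_const _ _) |>.congr_deriv
        (by simp)
    simp only [zero_add] at e3
    exact e1.deriv_eq.trans e3.deriv
  rw [← h1, ← h2, key, key]
  exact hsymm _ _

lemma lineDeriv_sub_fun {g h : X → ℝ} {z : X} (hg : SliceSmoothAt g z) (hh : SliceSmoothAt h z)
    (v : X) : lineDeriv ℝ (fun w => g w - h w) z v = lineDeriv ℝ g z v - lineDeriv ℝ h z v :=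
  deriv_fun_sub (hg.lineDifferentiableAt v) (hh.lineDifferentiableAt v)

lemma lineDeriv_mul_fun {g h : X → ℝ} {z : X} (hg : SliceSmoothAt g z) (hh : SliceSmoothAt h z)
    (v : X) : lineDeriv ℝ (fun w => g w * h w) z v =
      lineDeriv ℝ g z v * h z + g z * lineDeriv ℝ h z v := by
  have := deriv_fun_mul (hg.lineDifferentiableAt v) (hh.lineDifferentiableAt v)
  simpa [lineDeriv] using this

lemma lineDeriv_linear (l : X →ₗ[ℝ] ℝ) (z v : X) : lineDeriv ℝ (fun w => l w) z v = l v := by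
  simp [lineDeriv]

/-- Second derivatives along a sum of directions. -/
lemma SliceSmoothAt.lineDeriv_lineDeriv_add {g : X → ℝ} {z : X} (hg : SliceSmoothAt g z)
    (v w p : X) :
    _root_.lineDeriv ℝ (fun x => _root_.lineDeriv ℝ g x (v + w)) z p =
      _root_.lineDeriv ℝ (fun x => _root_.lineDeriv ℝ g x v) z p +
        _root_.lineDeriv ℝ (fun x => _root_.lineDeriv ℝ g x w) z p := by
  rw [hg.lineDeriv_comm, (hg.lineDeriv p).lineDeriv_add, hg.lineDeriv_comm p v,
    hg.lineDeriv_comm p w]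

lemma SliceSmoothAt.lineDeriv_lineDeriv_smul {g : X → ℝ} {z : X} (hg : SliceSmoothAt g z)
    (c : ℝ) (v p : X) :
    _root_.lineDeriv ℝ (fun x => _root_.lineDeriv ℝ g x (c • v)) z p =
      c * _root_.lineDeriv ℝ (fun x => _root_.lineDeriv ℝ g x v) z p := by
  rw [hg.lineDeriv_comm, lineDeriv_smul, hg.lineDeriv_comm p v, smul_eq_mul]

lemma hasDerivAt_line {g : X → ℝ} {z v : X} {t : ℝ} (hg : SliceSmoothAt g (z + t • v)) :
    HasDerivAt (fun s : ℝ => g (z + s • v)) (lineDeriv ℝ g (z + t • v) v) t := by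
  have h := (hg.lineDifferentiableAt v).hasLineDerivAt
  have h' : HasDerivAt (fun s : ℝ => g (z + t • v + s • v))
      (lineDeriv ℝ g (z + t • v) v) (t - t) := by rw [sub_self]; exact h
  have := h'.comp_sub_const t t
  simpa [add_assoc, ← add_smul] using this

/-- A function all of whose line derivatives vanish on a convex set is constant. -/
lemma eq_of_lineDeriv_eq_zero {D : Set X} (hconv : Convex ℝ D) {g : X → ℝ}
    (hg : ∀ z ∈ D, SliceSmoothAt g z) {z w : X} (hz : z ∈ D) (hw : w ∈ D)
    (h0 : ∀ x ∈ D, lineDeriv ℝ g x (w - z) = 0) : g w = g z := by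
  have hmem : ∀ t ∈ Set.Icc (0 : ℝ) 1, z + t • (w - z) ∈ D := fun t ht =>
    hconv.add_smul_sub_mem hz hw ht
  have hd : ∀ t ∈ Set.Icc (0 : ℝ) 1, HasDerivAt (fun s : ℝ => g (z + s • (w - z))) 0 t := by
    intro t ht
    have := hasDerivAt_line (hg _ (hmem t ht))
    rwa [h0 _ (hmem t ht)] at this
  have := constant_of_has_deriv_right_zero (f := fun s : ℝ => g (z + s • (w - z)))
    (a := 0) (b := 1) (fun t ht => (hd t ht).continuousAt.continuousWithinAt)
    (fun t ht => (hd t ⟨ht.1, ht.2.le⟩).hasDerivWithinAt) 1 (by simp)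
  simpa using this

end Slice

/-- A smooth function on a product whose derivatives along the second factor are locally constant
is the sum of a function of the first factor and a linear function of the second. -/
lemma exists_linear_of_lineDeriv_const {B E : Type*} [AddCommGroup B] [Module ℝ B]
    [AddCommGroup E] [Module ℝ E] {D : Set (B × E)} (hconv : Convex ℝ D) {g : B × E → ℝ}
    (hg : ∀ z ∈ D, SliceSmoothAt g z) (hne : D.Nonempty)
    (h0 : ∀ z ∈ D, ∀ (p : E) (v : B × E),
      lineDeriv ℝ (fun x => lineDeriv ℝ g x (0, p)) z v = 0) :
    ∃ L : E →ₗ[ℝ] ℝ, (∀ z ∈ D, ∀ p, lineDeriv ℝ g z (0, p) = L p) ∧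
      ∀ b u u₀, (b, u) ∈ D → (b, u₀) ∈ D → g (b, u) = g (b, u₀) + L (u - u₀) := by
  obtain ⟨z₀, hz₀⟩ := hne
  have hL : ∀ z ∈ D, ∀ p, lineDeriv ℝ g z (0, p) = lineDeriv ℝ g z₀ (0, p) := fun z hz p =>
    eq_of_lineDeriv_eq_zero hconv (g := fun x => lineDeriv ℝ g x (0, p))
      (fun x hx => (hg x hx).lineDeriv _) hz₀ hz (fun x hx => h0 x hx p _)
  refine ⟨(hg z₀ hz₀).lineDerivₗ ∘ₗ LinearMap.inr ℝ B E, hL, fun b u u₀ hu hu₀ => ?_⟩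
  set L := (hg z₀ hz₀).lineDerivₗ ∘ₗ LinearMap.inr ℝ B E with hLdef
  -- After subtraction of `L`, the derivative along `u - u₀` vanishes on all of `D`.
  have key := eq_of_lineDeriv_eq_zero hconv
    (g := fun x => g x - (L ∘ₗ LinearMap.snd ℝ B E) x)
    (fun x hx => (hg x hx).sub (sliceSmoothAt_linear _ x)) hu₀ hu (fun x hx => by
      rw [lineDeriv_sub_fun (hg x hx) (sliceSmoothAt_linear _ x), lineDeriv_linear]
      have : (b, u) - (b, u₀) = ((0 : B), u - u₀) := by simp
      rw [this, hL x hx]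
      simp [hLdef, SliceSmoothAt.lineDerivₗ])
  simp at key
  rw [map_sub]
  linarith

/-! ### Boxes of configurations -/

section Box

variable {c : Chain}

lemma ofCoords_apply (S : Finset c.sites) (a : S → ℝ) (n : c.sites) :
    c.ofCoords S a n = if h : n ∈ S then a ⟨n, h⟩ else 0 := by
  classical
  rw [Chain.ofCoords, Finsupp.finsetSum_apply]
  split_ifs with h
  · rw [Finset.sum_eq_single ⟨n, h⟩]
    · simp
    · intro b _ hb
      rw [Finsupp.single_apply, if_neg (fun h' => hb (Subtype.ext h'))]
    · simp
  · refine Finset.sum_eq_zero fun b _ => ?_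
    rw [Finsupp.single_apply, if_neg]
    rintro rfl
    exact h b.2

lemma ofCoords_restrict {S : Finset c.sites} {u : c.Config} (hu : u.support ⊆ S) :
    c.ofCoords S (fun n => u n) = u := by
  ext n
  rw [ofCoords_apply]
  split_ifs with h
  · rfl
  · exact (Finsupp.notMem_support_iff.1 fun h' => h (hu h')).symm

lemma exists_finset_support {ι V : Type*} [AddCommGroup V] [Module ℝ V]
    [FiniteDimensional ℝ V] (l : V →ₗ[ℝ] (ι →₀ ℝ)) :
    ∃ S : Finset ι, ∀ a, (l a).support ⊆ S := by
  classical
  let b := Module.finBasis ℝ V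
  refine ⟨Finset.univ.biUnion fun i => (l (b i)).support, fun a n hn => ?_⟩
  by_contra hS
  have h0 : Finsupp.lapply n ∘ₗ l = (0 : V →ₗ[ℝ] ℝ) := by
    refine b.ext fun i => ?_
    by_contra h
    exact hS (Finset.mem_biUnion.2 ⟨i, Finset.mem_univ _, Finsupp.mem_support_iff.2 h⟩)
  exact Finsupp.mem_support_iff.1 hn (LinearMap.congr_fun h0 a)

/-- The domain `b ∈ Q`, `u_n ∈ U n`. -/
def boxDomain {B : Type*} (c : Chain) (Q : Set B) (U : ℤ → Set ℝ) : Set (B × c.Config) :=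
  {z | z.1 ∈ Q ∧ c.InBox U z.2}

lemma inBox_ofCoords_nhds {U : ℤ → Set ℝ} (hU : ∀ n, IsOpen (U n)) {S : Finset c.sites}
    {u : c.Config} (hu : c.InBox U u) (hS : u.support ⊆ S) :
    ∀ᶠ a in 𝓝 (fun n : S => u n), c.InBox U (c.ofCoords S a) := by
  have h : ∀ᶠ a in 𝓝 (fun n : S => u n), ∀ n : S, a n ∈ U n := by
    rw [eventually_all]
    intro n
    exact (continuous_apply n).continuousAt.eventually_mem ((hU n).mem_nhds (hu n))
  filter_upwards [h] with a ha n
  rw [ofCoords_apply]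
  split_ifs with hn
  · exact ha ⟨n, hn⟩
  · have := hu n
    rwa [Finsupp.notMem_support_iff.1 fun h' => hn (hS h')] at this

/-- A finite-dimensional slice moves only finitely many coordinates, so smoothness in each finite
set of fields suffices for slice smoothness. The set `S` also contains the support of the base
point, so that all other coordinates stay `0`. -/
lemma slice_coords {B : Type*} [NormedAddCommGroup B] [NormedSpace ℝ B] (z : B × c.Config)
    {V : Type} [NormedAddCommGroup V] [NormedSpace ℝ V] [FiniteDimensional ℝ V]
    (A : V →ₗ[ℝ] B × c.Config) :
    ∃ (S : Finset c.sites) (f : V → B × (S → ℝ)), ContDiff ℝ ∞ f ∧ z.2.support ⊆ S ∧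
      f 0 = (z.1, fun n : S => z.2 n) ∧ ∀ a, z + A a = ((f a).1, c.ofCoords S (f a).2) := by
  classical
  obtain ⟨S, hS⟩ := exists_finset_support (LinearMap.snd ℝ B c.Config ∘ₗ A)
  refine ⟨z.2.support ∪ S, fun a => (z.1 + LinearMap.toContinuousLinearMap
    (LinearMap.fst ℝ B c.Config ∘ₗ A) a, fun n : ↥(z.2.support ∪ S) => z.2 n +
    LinearMap.toContinuousLinearMap (Finsupp.lapply n.1 ∘ₗ LinearMap.snd ℝ B c.Config ∘ₗ A) a), ?_, Finset.subset_union_left,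
    by simp only [map_zero, add_zero], fun a => ?_⟩
  · refine ContDiff.prodMk (contDiff_const.add (ContinuousLinearMap.contDiff _)) ?_
    exact contDiff_pi.2 fun n => contDiff_const.add (ContinuousLinearMap.contDiff _)
  · refine Prod.ext rfl ?_
    have : (z + A a).2.support ⊆ z.2.support ∪ S :=
      Finsupp.support_add.trans (Finset.union_subset_union_right (hS a))
    rw [← ofCoords_restrict this]
    rfl

lemma boxDomain_coords_nhds {B : Type*} [TopologicalSpace B] {Q : Set B} (hQ : IsOpen Q)
    {U : ℤ → Set ℝ} (hU : ∀ n, IsOpen (U n)) {z : B × c.Config} (hz : z ∈ boxDomain c Q U)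
    {S : Finset c.sites} (hS : z.2.support ⊆ S) :
    ∀ᶠ w : B × (S → ℝ) in 𝓝 (z.1, fun n : S => z.2 n),
      w.1 ∈ Q ∧ c.InBox U (c.ofCoords S w.2) := by
  have h1 : Tendsto Prod.fst (𝓝 (z.1, fun n : S => z.2 n)) (𝓝 z.1) := continuous_fst.tendsto _
  have h2 : Tendsto Prod.snd (𝓝 (z.1, fun n : S => z.2 n)) (𝓝 fun n : S => z.2 n) :=
    continuous_snd.tendsto _
  exact (h1.eventually_mem (hQ.mem_nhds hz.1)).and
    (h2.eventually (inBox_ofCoords_nhds hU hz.2 hS))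

lemma sliceOpen_boxDomain {B : Type*} [NormedAddCommGroup B] [NormedSpace ℝ B] {Q : Set B}
    (hQ : IsOpen Q) {U : ℤ → Set ℝ} (hU : ∀ n, IsOpen (U n)) : SliceOpen (boxDomain c Q U) := by
  intro z hz V _ _ _ A
  obtain ⟨S, f, hf, hS, hf0, hA⟩ := slice_coords z A
  have h1 : Tendsto f (𝓝 0) (𝓝 (z.1, fun n : S => z.2 n)) := hf.continuous.tendsto' _ _ hf0
  have h2 := boxDomain_coords_nhds hQ hU hz hS
  filter_upwards [h1.eventually h2] with a ha
  rw [hA]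
  exact ha

lemma Chain.InBox.exists_add_single {U : ℤ → Set ℝ} (hU : ∀ n, IsOpen (U n)) {u : c.Config}
    (hu : c.InBox U u) (k : c.sites) :
    ∃ s : ℝ, s ≠ 0 ∧ c.InBox U (u + s • Finsupp.single k 1) := by
  have hopen := (sliceOpen_boxDomain (c := c) (B := ℝ) isOpen_univ hU).eventually_line
    (z := (0, u)) ⟨trivial, hu⟩ (0, Finsupp.single k 1)
  obtain ⟨s, hs, hs0⟩ := ((hopen.filter_mono nhdsWithin_le_nhds).and
    (self_mem_nhdsWithin (s := {(0 : ℝ)}ᶜ))).exists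
  exact ⟨s, hs0, hs.2⟩

lemma sliceSmoothAt_of_contDiffOn {B : Type*} [NormedAddCommGroup B] [NormedSpace ℝ B]
    {Q : Set B} (hQ : IsOpen Q) {U : ℤ → Set ℝ} (hU : ∀ n, IsOpen (U n)) {g : B × c.Config → ℝ}
    (hg : ∀ S : Finset c.sites, ContDiffOn ℝ ∞ (fun w : B × (S → ℝ) => g (w.1, c.ofCoords S w.2))
      {w | w.1 ∈ Q ∧ c.InBox U (c.ofCoords S w.2)}) {z : B × c.Config}
    (hz : z ∈ boxDomain c Q U) : SliceSmoothAt g z := by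
  intro V _ _ _ A
  obtain ⟨S, f, hf, hS, hf0, hA⟩ := slice_coords z A
  have h2 := boxDomain_coords_nhds hQ hU hz hS
  rw [← hf0] at h2
  have h3 := (hg S).contDiffAt h2
  have h4 := ContDiffAt.comp (0 : V) h3 hf.contDiffAt
  exact h4.congr_of_eventuallyEq (Eventually.of_forall fun a => congrArg g (hA a))

lemma inBox_convex {U : ℤ → Set ℝ} (hU : ∀ n, (U n).OrdConnected) :
    Convex ℝ {u : c.Config | c.InBox U u} := by
  intro u hu v hv a b ha hb hab n
  have := (hU n).convex (hu n) (hv n) ha hb hab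
  simpa using this

lemma convex_boxDomain {B : Type*} [AddCommGroup B] [Module ℝ B] {Q : Set B}
    (hQ : Convex ℝ Q) {U : ℤ → Set ℝ} (hU : ∀ n, (U n).OrdConnected) :
    Convex ℝ (boxDomain c Q U) :=
  hQ.prod (inBox_convex hU)

/-- The box is nonempty when all but finitely many of its sides contain `0`. -/
lemma exists_inBox {U : ℤ → Set ℝ} (hU : ∀ n, (U n).Nonempty) {N : ℕ}
    (hU0 : ∀ n : ℤ, n ∉ Set.Icc 1 (N : ℤ) → (0 : ℝ) ∈ U n) : ∃ u : c.Config, c.InBox U u := by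
  classical
  have hfin : {n : c.sites | (n : ℤ) ∈ Set.Icc 1 (N : ℤ)}.Finite :=
    (Set.finite_Icc 1 (N : ℤ)).preimage Subtype.val_injective.injOn
  refine ⟨Finsupp.onFinset hfin.toFinset (fun n => if (n : ℤ) ∈ Set.Icc 1 (N : ℤ) then
    (hU n).some else 0) (fun n hn => ?_), fun n => ?_⟩
  · by_contra h
    simp only [Set.Finite.mem_toFinset, Set.mem_ofPred_eq] at h
    exact hn (if_neg h)
  · simp only [Finsupp.onFinset_apply]
    split_ifs with h
    · exact (hU n).some_mem
    · exact hU0 n h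

lemma IsOpenInterval.convex {I : Set ℝ} (hI : IsOpenInterval I) : Convex ℝ I := hI.2.1.convex

/-- The uncurried form of a coefficient of a field theory. -/
def uncurry₃ (g : ℝ → ℝ → c.Config → ℝ) : (ℝ × ℝ) × c.Config → ℝ := fun z => g z.1.1 z.1.2 z.2

/-- The uncurried form of a coefficient of a lattice. -/
def uncurry₂ (g : ℝ → c.Config → ℝ) : ℝ × c.Config → ℝ := fun z => g z.1 z.2

lemma FieldSmooth.sliceSmoothAt {I J : Set ℝ} {U : ℤ → Set ℝ} (hI : IsOpen I) (hJ : IsOpen J)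
    (hU : ∀ n, IsOpen (U n)) {g : ℝ → ℝ → c.Config → ℝ} (hg : FieldSmooth c I J U g)
    {z : (ℝ × ℝ) × c.Config} (hz : z ∈ boxDomain c (I ×ˢ J) U) :
    SliceSmoothAt (uncurry₃ g) z := by
  refine sliceSmoothAt_of_contDiffOn (hI.prod hJ) hU (fun S => ?_) hz
  have h : ContDiff ℝ ∞ (fun w : (ℝ × ℝ) × (S → ℝ) => (w.1.1, w.1.2, w.2)) := by fun_prop
  exact (hg S).comp h.contDiffOn fun w hw => ⟨hw.1.1, hw.1.2, hw.2⟩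

lemma LatticeSmooth.sliceSmoothAt {I : Set ℝ} {U : ℤ → Set ℝ} (hI : IsOpen I)
    (hU : ∀ n, IsOpen (U n)) {g : ℝ → c.Config → ℝ} (hg : LatticeSmooth c I U g)
    {z : ℝ × c.Config} (hz : z ∈ boxDomain c I U) :
    SliceSmoothAt (uncurry₂ g) z :=
  sliceSmoothAt_of_contDiffOn (g := uncurry₂ g) hI hU hg hz

lemma lineDeriv_uncurry₃ (g : ℝ → ℝ → c.Config → ℝ) (x y : ℝ) (u p : c.Config) :
    lineDeriv ℝ (g x y) u p = lineDeriv ℝ (uncurry₃ g) ((x, y), u) (0, p) := by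
  simp [lineDeriv, uncurry₃]

lemma lineDeriv_uncurry₂ (g : ℝ → c.Config → ℝ) (t : ℝ) (u p : c.Config) :
    lineDeriv ℝ (g t) u p = lineDeriv ℝ (uncurry₂ g) (t, u) (0, p) := by
  simp [lineDeriv, uncurry₂]

end Box

/-! ### Total derivatives as line derivatives -/

section Total

variable {c : Chain}

lemma totalX_eq (g : ℝ → ℝ → c.Config → ℝ) (x y : ℝ) (u p : c.Config) :
    totalX g x y u p =
      lineDeriv ℝ (uncurry₃ g) ((x, y), u) ((1, 0), p) := by
  simp [totalX, lineDeriv, uncurry₃]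

lemma totalY_eq (g : ℝ → ℝ → c.Config → ℝ) (x y : ℝ) (u q : c.Config) :
    totalY g x y u q =
      lineDeriv ℝ (uncurry₃ g) ((x, y), u) ((0, 1), q) := by
  simp [totalY, lineDeriv, uncurry₃]

lemma totalXY_eq (g : ℝ → ℝ → c.Config → ℝ) (x y : ℝ) (u p q : c.Config) :
    totalXY g x y u p q =
      lineDeriv ℝ (fun w => lineDeriv ℝ (uncurry₃ g) w
        ((0, 1), q)) ((x, y), u) ((1, 0), p) + c.forceDeriv (g x y) u := by
  simp [totalXY, lineDeriv, uncurry₃]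

lemma totalT_eq (g : ℝ → c.Config → ℝ) (t : ℝ) (u p : c.Config) :
    totalT g t u p = lineDeriv ℝ (uncurry₂ g) (t, u) (1, p) := by
  simp [totalT, lineDeriv, uncurry₂]

lemma totalTT_eq (g : ℝ → c.Config → ℝ) (t : ℝ) (u p : c.Config) :
    totalTT g t u p =
      lineDeriv ℝ (fun w => lineDeriv ℝ (uncurry₂ g) w (1, p)) (t, u)
        (1, p) + c.forceDeriv (g t) u := by
  have h : ∀ s : ℝ, deriv (fun s : ℝ => g (t + s) (u + s • p)) s =
      lineDeriv ℝ (uncurry₂ g) ((t, u) + s • (1, p)) (1, p) := by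
    intro s
    have := deriv_comp_const_add (fun s : ℝ => g (t + s) (u + s • p)) s 0
    rw [add_zero] at this
    rw [← this]
    simp [lineDeriv, uncurry₂, add_smul, add_assoc]
  rw [totalTT, iteratedDeriv_succ, iteratedDeriv_one]
  simp only [funext h]
  rfl

lemma forceTerm_eq (G : c.Config → ℝ) (u : c.Config) (m : ℤ) :
    c.forceTerm G u m = c.expo m u * lineDeriv ℝ G u (-c.rootOn m) := by
  simp [Chain.forceTerm, lineDeriv, sub_eq_add_neg]

end Total

/-! ### Roots and forces -/

section Force

variable {c : Chain}

/-- The pairing of a configuration of coefficients with a family of numbers. -/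
noncomputable def pair (a : c.Config) (φ : c.sites → ℝ) : ℝ := a.sum fun n x => x * φ n

lemma pair_eq_sum {a : c.Config} {S : Finset c.sites} (hS : a.support ⊆ S) (φ : c.sites → ℝ) :
    pair a φ = ∑ n ∈ S, a n * φ n := Finsupp.sum_of_support_subset _ hS _ (by simp)

lemma pair_add_right (a : c.Config) (φ ψ : c.sites → ℝ) :
    pair a (fun n => φ n + ψ n) = pair a φ + pair a ψ := by
  simp [pair, Finsupp.sum, mul_add, Finset.sum_add_distrib]

lemma pair_smul_right (a : c.Config) (s : ℝ) (φ : c.sites → ℝ) :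
    pair a (fun n => s * φ n) = s * pair a φ := by
  simp only [pair, Finsupp.sum, Finset.mul_sum]
  exact Finset.sum_congr rfl fun _ _ => by ring

lemma pair_add_left (a b : c.Config) (φ : c.sites → ℝ) :
    pair (a + b) φ = pair a φ + pair b φ :=
  Finsupp.sum_add_index' (by simp) (by intros; ring)

lemma pair_neg_left (a : c.Config) (φ : c.sites → ℝ) : pair (-a) φ = -pair a φ := by
  simp [pair, Finsupp.sum]

lemma pair_sub_left (a b : c.Config) (φ : c.sites → ℝ) :
    pair (a - b) φ = pair a φ - pair b φ := by
  rw [sub_eq_add_neg, pair_add_left, pair_neg_left, sub_eq_add_neg]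

@[simp] lemma pair_zero_left (φ : c.sites → ℝ) : pair (0 : c.Config) φ = 0 := by simp [pair]

@[simp] lemma pair_single_left (n : c.sites) (x : ℝ) (φ : c.sites → ℝ) :
    pair (Finsupp.single n x) φ = x * φ n := by simp [pair]

lemma expo_eq (m : ℤ) (u : c.Config) : c.expo m u = Real.exp (pair (c.rootOn m) u) := rfl

lemma expo_pos (m : ℤ) (u : c.Config) : 0 < c.expo m u := Real.exp_pos _

lemma expo_add_smul (m : ℤ) (u w : c.Config) (s : ℝ) :
    c.expo m (u + s • w) = Real.exp (s * pair (c.rootOn m) w) * c.expo m u := by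
  rw [expo_eq, expo_eq, ← Real.exp_add]
  congr 1
  rw [← pair_smul_right, ← pair_add_right]
  congr 1
  ext n
  simp [add_comm]

@[simp] lemma rootOn_apply (m : ℤ) (n : c.sites) : c.rootOn m n = c.root m n := rfl

/-- The indices of the roots that can involve a given site. -/
def near (n : ℤ) : Finset ℤ := {n - 1, n, 0}

lemma bond_apply (m n : ℤ) : bond m n = (if m = n then 1 else 0) - (if m + 1 = n then 1 else 0) := by
  simp [bond, Finsupp.single_apply]

lemma root_apply_eq_zero {m n : ℤ} (h : m ∉ near n) : c.root m n = 0 := by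
  simp only [near, Finset.mem_insert, Finset.mem_singleton, not_or] at h
  obtain ⟨h1, h2, h3⟩ := h
  have hb : bond m n = 0 := by
    rw [bond_apply, if_neg h2, if_neg (by omega), sub_zero]
  cases c with
  | infinite => exact hb
  | semiInfinite T => simp only [Chain.root]; split_ifs <;> simp [hb]
  | finite T N => simp only [Chain.root]; split_ifs <;> simp [hb]

lemma force_eq (n : c.sites) (u : c.Config) :
    c.force n u = -∑ m ∈ near n, c.rootOn m n * c.expo m u := by
  rw [Chain.force, finsum_eq_sum_of_support_subset (s := near n), ← Finset.sum_neg_distrib]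
  · exact Finset.sum_congr rfl fun _ _ => by ring
  · intro m hm
    by_contra h
    exact hm (by simp [root_apply_eq_zero (c := c) (show m ∉ near n from h)])

lemma hasDerivAt_expo (m : ℤ) (u w : c.Config) :
    HasDerivAt (fun s : ℝ => c.expo m (u + s • w)) (pair (c.rootOn m) w * c.expo m u) 0 := by
  simp only [expo_add_smul]
  have h : HasDerivAt (fun s : ℝ => s * pair (c.rootOn m) w) (pair (c.rootOn m) w) 0 := by
    simpa using (hasDerivAt_id (0 : ℝ)).mul_const (pair (c.rootOn m) w)
  simpa using h.exp.mul_const (c.expo m u)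

lemma pair_single_right (a : c.Config) (l : c.sites) :
    pair a (Finsupp.single l 1 : c.Config) = a l := by
  classical
  rw [pair_eq_sum (Finset.subset_insert l a.support), Finset.sum_eq_single l]
  · simp
  · intro b _ hb
    simp [hb.symm]
  · simp

lemma deriv_force (n l : c.sites) (u : c.Config) :
    deriv (fun s : ℝ => c.force n (u + Finsupp.single l s)) 0 =
      -∑ m ∈ near n, c.rootOn m n * (c.rootOn m l * c.expo m u) := by
  have h : HasDerivAt (fun s : ℝ => c.force n (u + s • Finsupp.single l 1))
      (-∑ m ∈ near n, c.rootOn m n * (pair (c.rootOn m) (Finsupp.single l 1 : c.Config) *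
        c.expo m u)) 0 := by
    simp only [force_eq]
    exact (HasDerivAt.fun_sum fun m _ => (hasDerivAt_expo m u _).const_mul _).neg
  simp only [pair_single_right] at h
  simpa using h.deriv

/-- The sums over sites and over roots are exchanged. Only the finitely many sites in the supports
of the roots near `n` contribute, so `φ` may be arbitrary even on an infinite chain. -/
lemma finsum_mul_deriv_force (n : c.sites) (u : c.Config) (φ : c.sites → ℝ) :
    ∑ᶠ l : c.sites, φ l * deriv (fun s : ℝ => c.force n (u + Finsupp.single l s)) 0 =
      -∑ m ∈ near n, c.rootOn m n * c.expo m u * pair (c.rootOn m) φ := by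
  classical
  set S := (near n).biUnion fun m => (c.rootOn m).support with hS
  have hsub : ∀ m ∈ near n, (c.rootOn m).support ⊆ S := fun m hm =>
    Finset.subset_biUnion_of_mem (fun m => (c.rootOn m).support) hm
  rw [finsum_eq_sum_of_support_subset (s := S)]
  · simp only [deriv_force, mul_neg, Finset.sum_neg_distrib, Finset.mul_sum]
    rw [Finset.sum_comm]
    congr 1
    refine Finset.sum_congr rfl fun m hm => ?_
    rw [pair_eq_sum (hsub m hm), Finset.mul_sum]
    exact Finset.sum_congr rfl fun _ _ => by ring
  · intro l hl
    by_contra h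
    refine hl ?_
    have h0 : ∀ m ∈ near n, c.rootOn m l = 0 := fun m hm =>
      Finsupp.notMem_support_iff.1 fun h' => h (hsub m hm h')
    simp only [deriv_force]
    rw [Finset.sum_eq_zero fun m hm => by rw [h0 m hm]; ring]
    simp

lemma forceDeriv_eq_zero {G : c.Config → ℝ} {u : c.Config} (h : ∀ v, lineDeriv ℝ G u v = 0) :
    c.forceDeriv G u = 0 := by
  simp [Chain.forceDeriv, forceTerm_eq, h]

end Force

/-! ### Independence of exponential polynomials -/

/-- The exponents `0`, `1` and `-a` are distinct, so the exponential polynomials are independent.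
The values `a = 1, 2` are the only ones that occur as pairings with the end of the chain. -/
lemma coeff_eq_zero_of_exp_relation {a : ℝ} (ha : a = 1 ∨ a = 2) {k₀ k₁ A B C D : ℝ}
    (h : ∀ᶠ s : ℝ in 𝓝 0, k₀ + k₁ * s =
      Real.exp s * (A + B * s) + Real.exp (-a * s) * (C + D * s)) : A = 0 ∧ C = 0 := by
  -- Differentiation preserves the shape of the relation and acts linearly on its six coefficients.
  have step : ∀ k₀ k₁ A B C D : ℝ, (∀ᶠ s : ℝ in 𝓝 0, k₀ + k₁ * s =
      Real.exp s * (A + B * s) + Real.exp (-a * s) * (C + D * s)) →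
      k₀ = A + C ∧ ∀ᶠ s : ℝ in 𝓝 0, k₁ + 0 * s =
      Real.exp s * (A + B + B * s) + Real.exp (-a * s) * (D - a * C + -a * D * s) := by
    intro k₀ k₁ A B C D h
    refine ⟨by simpa using h.self_of_nhds, ?_⟩
    filter_upwards [h.eventually_nhds] with s hs
    have h1 : HasDerivAt (fun s : ℝ => k₀ + k₁ * s) k₁ s := by
      simpa using ((hasDerivAt_id s).const_mul k₁).const_add k₀
    have h2 : ∀ P Q : ℝ, HasDerivAt (fun s : ℝ => P + Q * s) Q s := fun P Q => by
      simpa using ((hasDerivAt_id s).const_mul Q).const_add P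
    have h3 : HasDerivAt (fun s : ℝ => Real.exp (-a * s)) (Real.exp (-a * s) * -a) s := by
      simpa using ((hasDerivAt_id s).const_mul (-a)).exp
    have h4 := ((Real.hasDerivAt_exp s).mul (h2 A B)).add (h3.mul (h2 C D))
    have h5 := h1.unique (h4.congr_of_eventuallyEq hs)
    rw [zero_mul, add_zero, h5]
    ring
  -- Two differentiations remove `k₀` and `k₁`. The derivatives of orders 2 to 5 at `0` are then
  -- four homogeneous linear equations in `A`, `B`, `C`, `D`.
  obtain ⟨-, h1⟩ := step _ _ _ _ _ _ h
  obtain ⟨-, h2⟩ := step _ _ _ _ _ _ h1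
  obtain ⟨e2, h3⟩ := step _ _ _ _ _ _ h2
  obtain ⟨e3, h4⟩ := step _ _ _ _ _ _ h3
  obtain ⟨e4, h5⟩ := step _ _ _ _ _ _ h4
  obtain ⟨e5, -⟩ := step _ _ _ _ _ _ h5
  rcases ha with rfl | rfl <;> constructor <;> linarith

/-- Separation of the exponentials in a sum along a line on which just two of the exponents
vary. -/
lemma coeff_eq_zero_of_tsum_relation {r : ℝ} (hr : r = 1 ∨ r = 2) {m : ℤ} (hm : m ≠ 0)
    {a b P Q : ℤ → ℝ} {F : Finset ℤ} (hF : ∀ j ∉ F, b j = 0) {d : ℤ → ℝ} (hdm : d m = 1)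
    (hd0 : d 0 = -r) (hd : ∀ j, j ≠ m → j ≠ 0 → d j = 0) (ha : Summable a) {k₀ k₁ : ℝ}
    (h : ∀ᶠ s : ℝ in 𝓝 0, k₀ + k₁ * s =
      ∑' j, Real.exp (s * d j) * a j - ∑ j ∈ F, Real.exp (s * d j) * b j * (P j + s * Q j)) :
    a m = b m * P m ∧ a 0 = b 0 * P 0 := by
  classical
  set S : Finset ℤ := insert m {0} with hS
  -- Outside `{m, 0}` the factors `exp (s * d j)` are `1`. The series then contributes a constant
  -- and the finite sum an affine function of `s`; exponentials remain only in the corrections at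
  -- `m` and `0`.
  have key : ∀ s : ℝ, ∑' j, Real.exp (s * d j) * a j -
      ∑ j ∈ F, Real.exp (s * d j) * b j * (P j + s * Q j) =
      (∑' j, a j - ∑ j ∈ F, b j * P j - (a m - b m * P m) - (a 0 - b 0 * P 0)) +
      (-∑ j ∈ F, b j * Q j + b m * Q m + b 0 * Q 0) * s +
      (Real.exp s * (a m - b m * P m + -(b m * Q m) * s) +
        Real.exp (-r * s) * (a 0 - b 0 * P 0 + -(b 0 * Q 0) * s)) := by
    intro s
    have hsupp : ∀ j ∉ S, Real.exp (s * d j) = 1 := by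
      intro j hj
      simp only [hS, Finset.mem_insert, Finset.mem_singleton, not_or] at hj
      rw [hd j hj.1 hj.2, mul_zero, Real.exp_zero]
    have e1 : ∑' j, Real.exp (s * d j) * a j =
        ∑' j, a j + ∑ j ∈ S, (Real.exp (s * d j) - 1) * a j := by
      have hz : ∀ j ∉ S, (Real.exp (s * d j) - 1) * a j = 0 := fun j hj => by
        rw [hsupp j hj]; ring
      have hs : Summable fun j => (Real.exp (s * d j) - 1) * a j := summable_of_ne_finset_zero hz
      rw [← tsum_eq_sum (L := SummationFilter.unconditional ℤ) hz, ← ha.tsum_add hs]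
      exact tsum_congr fun j => by ring
    have e2 : ∑ j ∈ F, Real.exp (s * d j) * b j * (P j + s * Q j) =
        ∑ j ∈ F, b j * (P j + s * Q j) +
          ∑ j ∈ S, (Real.exp (s * d j) - 1) * (b j * (P j + s * Q j)) := by
      have hl : ∀ f : ℤ → ℝ, ∑ j ∈ F, f j * (b j * (P j + s * Q j)) =
          ∑ j ∈ F ∪ S, f j * (b j * (P j + s * Q j)) := fun f =>
        Finset.sum_subset Finset.subset_union_left fun j _ hj => by rw [hF j hj]; ring
      have hl2 : ∑ j ∈ S, (Real.exp (s * d j) - 1) * (b j * (P j + s * Q j)) =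
          ∑ j ∈ F ∪ S, (Real.exp (s * d j) - 1) * (b j * (P j + s * Q j)) :=
        Finset.sum_subset Finset.subset_union_right fun j _ hj => by rw [hsupp j hj]; ring
      rw [hl2, ← hl, ← Finset.sum_add_distrib]
      exact Finset.sum_congr rfl fun j _ => by ring
    have e3 : ∀ f : ℤ → ℝ, ∑ j ∈ S, f j = f m + f 0 := fun f => by
      rw [hS, Finset.sum_insert (by simpa using hm), Finset.sum_singleton]
    have e4 : ∑ j ∈ F, b j * (P j + s * Q j) = ∑ j ∈ F, b j * P j + s * ∑ j ∈ F, b j * Q j := by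
      rw [Finset.mul_sum, ← Finset.sum_add_distrib]
      exact Finset.sum_congr rfl fun j _ => by ring
    rw [e1, e2, e3, e3, e4, hdm, hd0, mul_one, mul_comm s (-r)]
    ring
  have h' : ∀ᶠ s : ℝ in 𝓝 0,
      (k₀ - (∑' j, a j - ∑ j ∈ F, b j * P j - (a m - b m * P m) - (a 0 - b 0 * P 0))) +
      (k₁ - (-∑ j ∈ F, b j * Q j + b m * Q m + b 0 * Q 0)) * s =
      Real.exp s * (a m - b m * P m + -(b m * Q m) * s) +
        Real.exp (-r * s) * (a 0 - b 0 * P 0 + -(b 0 * Q 0) * s) := by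
    filter_upwards [h] with s hs
    rw [key s] at hs
    linarith
  obtain ⟨hA, hC⟩ := coeff_eq_zero_of_exp_relation hr h'
  exact ⟨by linarith, by linarith⟩

/-! ### Chains with a left end -/

/-- The chain begins at the site `1`, with the left end of the series `T`, and has at least two
sites. -/
structure Chain.IsLeftEnded (c : Chain) (T : Series) : Prop where
  one_le : ∀ n ∈ c.sites, 1 ≤ n
  two_mem : (2 : ℤ) ∈ c.sites
  mem_of_le : ∀ n ∈ c.sites, ∀ k : ℤ, 1 ≤ k → k ≤ n → k ∈ c.sites
  root_bond : ∀ m : ℤ, 1 ≤ m → m + 1 ∈ c.sites → c.root m = bond m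
  root_zero : c.root 0 = endRoot T
  root_other : ∀ m : ℤ, m ≠ 0 → ¬(1 ≤ m ∧ m + 1 ∈ c.sites) → c.root m = 0

lemma isLeftEnded_finite (T : Series) {N : ℕ} (hN : 2 ≤ N) :
    (Chain.finite T N).IsLeftEnded T where
  one_le _ h := h.1
  two_mem := ⟨by norm_num, by exact_mod_cast hN⟩
  mem_of_le _ h _ h1 h2 := ⟨h1, h2.trans h.2⟩
  root_bond _ h1 h2 := if_pos ⟨h1, h2.2⟩
  root_zero := by simp [Chain.root]
  root_other m h0 h1 := by
    have : ¬(1 ≤ m ∧ m + 1 ≤ (N : ℤ)) := fun h => h1 ⟨h.1, ⟨by omega, h.2⟩⟩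
    simp only [Chain.root, if_neg this, if_neg h0]

lemma isLeftEnded_semiInfinite (T : Series) : (Chain.semiInfinite T).IsLeftEnded T where
  one_le _ h := h
  two_mem := by simp [Chain.sites]
  mem_of_le _ _ _ h1 _ := h1
  root_bond _ h1 _ := if_pos h1
  root_zero := by simp [Chain.root]
  root_other m h0 h1 := by
    have : ¬(1 ≤ m) := fun h => h1 ⟨h, show (1 : ℤ) ≤ m + 1 by omega⟩
    simp [Chain.root, this, h0]

namespace Chain.IsLeftEnded

variable {c : Chain} {T : Series} (hc : c.IsLeftEnded T)

include hc

lemma one_mem : (1 : ℤ) ∈ c.sites := hc.mem_of_le 2 hc.two_mem 1 le_rfl (by norm_num)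

lemma rootOn_bond {m : ℤ} (h1 : 1 ≤ m) (h2 : m + 1 ∈ c.sites) :
    c.rootOn m = Finsupp.single ⟨m, hc.mem_of_le _ h2 m h1 (by omega)⟩ 1 -
      Finsupp.single ⟨m + 1, h2⟩ 1 := by
  classical
  ext n
  rw [rootOn_apply, hc.root_bond m h1 h2, bond_apply, Finsupp.sub_apply, Finsupp.single_apply,
    Finsupp.single_apply]
  simp only [Subtype.ext_iff]

lemma rootOn_zero : c.rootOn 0 = match T with
    | .A => 0
    | .B => -Finsupp.single ⟨1, hc.one_mem⟩ 1
    | .C => -Finsupp.single ⟨1, hc.one_mem⟩ 2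
    | .D => -Finsupp.single ⟨1, hc.one_mem⟩ 1 - Finsupp.single ⟨2, hc.two_mem⟩ 1 := by
  classical
  ext n
  rw [rootOn_apply, hc.root_zero]
  cases T <;> simp [endRoot, Finsupp.single_apply, Subtype.ext_iff]

lemma rootOn_other {m : ℤ} (h0 : m ≠ 0) (h : ¬(1 ≤ m ∧ m + 1 ∈ c.sites)) : c.rootOn m = 0 := by
  ext n
  rw [rootOn_apply, hc.root_other m h0 h]
  rfl

lemma pair_bond {m : ℤ} (h1 : 1 ≤ m) (h2 : m + 1 ∈ c.sites) (φ : c.sites → ℝ) :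
    pair (c.rootOn m) φ = φ ⟨m, hc.mem_of_le _ h2 m h1 (by omega)⟩ - φ ⟨m + 1, h2⟩ := by
  rw [hc.rootOn_bond h1 h2, pair_sub_left, pair_single_left, pair_single_left, one_mul, one_mul]

lemma pair_zero (φ : c.sites → ℝ) : pair (c.rootOn 0) φ = match T with
    | .A => 0
    | .B => -φ ⟨1, hc.one_mem⟩
    | .C => -(2 * φ ⟨1, hc.one_mem⟩)
    | .D => -φ ⟨1, hc.one_mem⟩ - φ ⟨2, hc.two_mem⟩ := by
  rw [hc.rootOn_zero]
  cases T <;> simp [pair_sub_left, pair_neg_left]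

/-- A configuration on which exactly one bond root and the additional root of the end do not
vanish. -/
lemma exists_step (m : ℤ) : ∃ w : c.Config, ∀ n : c.sites, w n = if (n : ℤ) ≤ m then 1 else 0 := by
  classical
  have hfin : {n : c.sites | (n : ℤ) ∈ Set.Icc 1 m}.Finite :=
    (Set.finite_Icc 1 m).preimage Subtype.val_injective.injOn
  refine ⟨Finsupp.onFinset hfin.toFinset (fun n => if (n : ℤ) ≤ m then 1 else 0) fun n hn => ?_,
    fun n => rfl⟩
  simp only [ne_eq, ite_eq_right_iff, one_ne_zero, imp_false, not_not] at hn
  simpa using ⟨hc.one_le n n.2, hn⟩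

omit hc

variable {U : ℤ → Set ℝ} {L Λ : c.sites → c.Config →ₗ[ℝ] ℝ} {f κ : c.sites → ℝ} {σ : ℝ}

/-- The coefficients of the exponentials in the determining equations vanish one by one. -/
lemma coeff_root_eq (hc : c.IsLeftEnded T) (hU : ∀ n, IsOpen (U n))
    (hsum : ∀ u, c.InBox U u → ∀ n, Summable fun m => c.expo m u * L n (c.rootOn m))
    (heq : ∀ u, c.InBox U u → ∀ n : c.sites, Λ n u + κ n =
      ∑' m, c.expo m u * L n (c.rootOn m) - ∑ m ∈ near n, c.rootOn m n * c.expo m u *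
        (σ + pair (c.rootOn m) fun l => L l u + f l))
    {u : c.Config} (hu : c.InBox U u) (n : c.sites) (m : ℤ) :
    L n (c.rootOn m) = c.rootOn m n * (σ + pair (c.rootOn m) fun l => L l u + f l) := by
  have main : ∀ m : ℤ, 1 ≤ m → m + 1 ∈ c.sites →
      L n (c.rootOn m) = c.rootOn m n * (σ + pair (c.rootOn m) fun l => L l u + f l) ∧
      L n (c.rootOn 0) = c.rootOn 0 n * (σ + pair (c.rootOn 0) fun l => L l u + f l) := by
    intro m h1 h2
    -- Along the step `w`, bond `m` has pairing `1`, every other bond has pairing `0`, and a nonzero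
    -- additional root has pairing `-r`. In series `D`, `r = 2` when the step covers both sites `1`
    -- and `2`, and `r = 1` when `m = 1`.
    obtain ⟨w, hw⟩ := hc.exists_step m
    obtain ⟨r, hr, hr0⟩ : ∃ r : ℝ, (r = 1 ∨ r = 2) ∧
        (c.rootOn 0 = 0 ∨ pair (c.rootOn 0) w = -r) := by
      rw [hc.pair_zero, hc.rootOn_zero]
      cases T with
      | A => exact ⟨1, Or.inl rfl, Or.inl rfl⟩
      | B => exact ⟨1, Or.inl rfl, Or.inr (by simp [hw, h1])⟩
      | C => exact ⟨2, Or.inr rfl, Or.inr (by simp [hw, h1])⟩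
      | D =>
        by_cases h : (2 : ℤ) ≤ m
        · exact ⟨2, Or.inr rfl, Or.inr (by simp [hw, h1, h]; norm_num)⟩
        · exact ⟨1, Or.inl rfl, Or.inr (by simp [hw, h1, h])⟩
    -- For series `A` the value `-r` at index `0` is purely formal: the root there is zero, and so
    -- are the coefficients it multiplies.
    let d : ℤ → ℝ := fun j => if j = 0 then -r else pair (c.rootOn j) w
    have hm0 : m ≠ 0 := by omega
    have hdm : d m = 1 := by
      simp only [d, if_neg hm0, hc.pair_bond h1 h2, hw]
      simp
    have hd : ∀ j, j ≠ m → j ≠ 0 → d j = 0 := by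
      intro j hj hj0
      simp only [d, if_neg hj0]
      by_cases hjb : 1 ≤ j ∧ j + 1 ∈ c.sites
      · rw [hc.pair_bond hjb.1 hjb.2, hw, hw]
        by_cases hjm : j ≤ m
        · rw [if_pos hjm, if_pos (show j + 1 ≤ m by omega), sub_self]
        · rw [if_neg hjm, if_neg (show ¬ j + 1 ≤ m by omega), sub_self]
      · rw [hc.rootOn_other hj0 hjb, pair_zero_left]
    have hexp : ∀ (j : ℤ) (s : ℝ), c.rootOn j = 0 ∨
        c.expo j (u + s • w) = Real.exp (s * d j) * c.expo j u := by
      intro j s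
      rw [expo_add_smul]
      by_cases hj : j = 0
      · subst hj
        rcases hr0 with h | h
        · exact Or.inl h
        · right; simp only [d, if_true, h]
      · right; simp only [d, if_neg hj]
    have key := coeff_eq_zero_of_tsum_relation hr hm0 (F := near n)
      (a := fun j => c.expo j u * L n (c.rootOn j)) (b := fun j => c.rootOn j n * c.expo j u)
      (P := fun j => σ + pair (c.rootOn j) fun l => L l u + f l)
      (Q := fun j => pair (c.rootOn j) fun l => L l w) (d := d)
      (fun j hj => by simp [root_apply_eq_zero (c := c) hj]) hdm (by simp [d]) hd
      (hsum u hu n) (k₀ := Λ n u + κ n) (k₁ := Λ n w) (by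
        have hopen : ∀ᶠ s : ℝ in 𝓝 0, c.InBox U (u + s • w) := by
          have := (sliceOpen_boxDomain (c := c) (B := ℝ) isOpen_univ hU).eventually_line
            (z := (0, u)) ⟨trivial, hu⟩ (0, w)
          filter_upwards [this] with s hs
          simpa [boxDomain] using hs
        filter_upwards [hopen] with s hs
        have h3 := heq _ hs n
        rw [map_add, map_smul, smul_eq_mul] at h3
        calc Λ n u + κ n + Λ n w * s = Λ n u + s * Λ n w + κ n := by ring
          _ = _ := h3
          _ = _ := by
            congr 1
            · refine tsum_congr fun j => ?_
              rcases hexp j s with h | h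
              · simp [h]
              · rw [h]; ring
            · refine Finset.sum_congr rfl fun j _ => ?_
              have hp : (pair (c.rootOn j) fun l => L l (u + s • w) + f l) =
                  (pair (c.rootOn j) fun l => L l u + f l) +
                    s * pair (c.rootOn j) fun l => L l w := by
                rw [← pair_smul_right, ← pair_add_right]
                congr 1
                ext l
                rw [map_add, map_smul, smul_eq_mul]
                ring
              rw [hp]
              rcases hexp j s with h | h
              · simp [h]
              · rw [h]; ring)
    constructor
    · refine mul_left_cancel₀ (expo_pos m u).ne' (key.1.trans ?_)
      ring
    · refine mul_left_cancel₀ (expo_pos 0 u).ne' (key.2.trans ?_)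
      ring
  by_cases h0 : m = 0
  · subst h0
    exact (main 1 le_rfl hc.two_mem).2
  by_cases hm : 1 ≤ m ∧ m + 1 ∈ c.sites
  · exact (main m hm.1 hm.2).1
  · simp [hc.rootOn_other h0 hm]

end Chain.IsLeftEnded

/-- The values at the first site that are compatible with the left end. -/
def endValue (σ f₁ : ℝ) : Series → Prop
  | .A => True
  | .B => f₁ = σ
  | .C => 2 * f₁ = σ
  | .D => f₁ = 0

/-- The solution of the determining equations of affine vertical fields. -/
theorem Chain.IsLeftEnded.solve {c : Chain} {T : Series} (hc : c.IsLeftEnded T)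
    {U : ℤ → Set ℝ} {L Λ : c.sites → c.Config →ₗ[ℝ] ℝ} {f κ : c.sites → ℝ} {σ : ℝ}
    (hU : ∀ n, IsOpen (U n)) (hne : ∃ u, c.InBox U u)
    (hsum : ∀ u, c.InBox U u → ∀ n, Summable fun m => c.expo m u * L n (c.rootOn m))
    (heq : ∀ u, c.InBox U u → ∀ n : c.sites, Λ n u + κ n =
      ∑' m, c.expo m u * L n (c.rootOn m) - ∑ m ∈ near n, c.rootOn m n * c.expo m u *
        (σ + pair (c.rootOn m) fun l => L l u + f l)) :
    (∃ b : ℝ, (T ≠ .A → b = 0) ∧ ∀ n u, L n u = b * u.sum fun _ a => a) ∧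
    (∀ u, c.InBox U u → ∀ n, Λ n u + κ n = 0) ∧
    (∀ n : c.sites, f n = f ⟨1, hc.one_mem⟩ + σ * (((n : ℤ) : ℝ) - 1)) ∧
    endValue σ (f ⟨1, hc.one_mem⟩) T := by
  have hcoef := fun {u} (hu : c.InBox U u) n m => hc.coeff_root_eq hU hsum heq hu n m
  obtain ⟨u₀, hu₀⟩ := hne
  -- the pairings with the roots do not depend on the fields
  have hconst : ∀ m n, c.rootOn m n ≠ 0 → ∀ k : c.sites,
      (pair (c.rootOn m) fun l => L l (Finsupp.single k 1)) = 0 := by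
    intro m n hmn k
    obtain ⟨s, hs0, hs'⟩ := hu₀.exists_add_single hU k
    have h1 := (hcoef hu₀ n m).symm.trans (hcoef hs' n m)
    have h2 := mul_left_cancel₀ hmn h1
    have hp : (pair (c.rootOn m) fun l => L l (u₀ + s • Finsupp.single k 1) + f l) =
        (pair (c.rootOn m) fun l => L l u₀ + f l) +
          s * pair (c.rootOn m) fun l => L l (Finsupp.single k 1) := by
      rw [← pair_smul_right, ← pair_add_right]
      congr 1
      ext l
      rw [map_add, map_smul, smul_eq_mul]
      ring
    rw [hp] at h2
    have h3 : s * (pair (c.rootOn m) fun l => L l (Finsupp.single k 1)) = 0 := by linarith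
    exact (mul_eq_zero.1 h3).resolve_left hs0
  -- The root `α_m` takes the values `1` and `-1` at the two sites of the bond. As the functionals
  -- there agree, the two coefficient equations have equal left sides and opposite right sides, so
  -- both sides vanish.
  have hbond : ∀ m : ℤ, ∀ (h1 : 1 ≤ m) (h2 : m + 1 ∈ c.sites),
      L ⟨m, hc.mem_of_le _ h2 m h1 (by omega)⟩ = L ⟨m + 1, h2⟩ ∧
      L ⟨m, hc.mem_of_le _ h2 m h1 (by omega)⟩ (c.rootOn m) = 0 ∧
      f ⟨m + 1, h2⟩ = f ⟨m, hc.mem_of_le _ h2 m h1 (by omega)⟩ + σ := by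
    intro m h1 h2
    have hmem := hc.mem_of_le _ h2 m h1 (by omega)
    have hα1 : c.rootOn m ⟨m, hmem⟩ = 1 := by
      simp [hc.root_bond m h1 h2, bond_apply]
    have hα2 : c.rootOn m ⟨m + 1, h2⟩ = -1 := by
      simp [hc.root_bond m h1 h2, bond_apply]
    have hL : L ⟨m, hmem⟩ = L ⟨m + 1, h2⟩ := by
      refine Finsupp.lhom_ext' fun k => LinearMap.ext_ring ?_
      have := hconst m ⟨m, hmem⟩ (by rw [hα1]; norm_num) k
      rw [hc.pair_bond h1 h2, sub_eq_zero] at this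
      exact this
    have e1 := hcoef hu₀ ⟨m, hmem⟩ m
    have e2 := hcoef hu₀ ⟨m + 1, h2⟩ m
    rw [hα1, hc.pair_bond h1 h2, ← hL] at e1
    rw [hα2, hc.pair_bond h1 h2, ← hL] at e2
    exact ⟨hL, by linarith, by linarith⟩
  -- induction along the chain
  have hind : ∀ k : ℕ, ∀ hk : (1 + k : ℤ) ∈ c.sites,
      L ⟨1 + k, hk⟩ = L ⟨1, hc.one_mem⟩ ∧
      L ⟨1, hc.one_mem⟩ (Finsupp.single ⟨1 + k, hk⟩ 1) =
        L ⟨1, hc.one_mem⟩ (Finsupp.single ⟨1, hc.one_mem⟩ 1) ∧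
      f ⟨1 + k, hk⟩ = f ⟨1, hc.one_mem⟩ + σ * k := by
    intro k
    induction k with
    | zero => intro hk; simp
    | succ k ih =>
      intro hk
      have hk' : ((1 + k : ℤ)) + 1 ∈ c.sites := by
        have : (1 + (k + 1 : ℕ) : ℤ) = 1 + k + 1 := by push_cast; ring
        rwa [this] at hk
      have hcast : (⟨1 + (k + 1 : ℕ), hk⟩ : c.sites) = ⟨1 + k + 1, hk'⟩ :=
        Subtype.ext (by push_cast; ring)
      have hmem := hc.mem_of_le _ hk' (1 + k) (by omega) (by omega)
      obtain ⟨i1, i2, i3⟩ := ih hmem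
      obtain ⟨b1, b2, b3⟩ := hbond (1 + k) (by omega) hk'
      rw [hcast]
      refine ⟨b1.symm.trans i1, ?_, ?_⟩
      · rw [i1, hc.rootOn_bond (by omega) hk', map_sub, i2] at b2
        linarith
      · rw [b3, i3]; push_cast; ring
  have hnat : ∀ n : c.sites, ∃ (k : ℕ) (hk : (1 + k : ℤ) ∈ c.sites), n = ⟨1 + k, hk⟩ := by
    intro n
    have h1 := hc.one_le n n.2
    have hk : (1 + ((n : ℤ) - 1).toNat : ℤ) = n := by omega
    exact ⟨((n : ℤ) - 1).toNat, by rw [hk]; exact n.2, Subtype.ext hk.symm⟩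
  set b := L ⟨1, hc.one_mem⟩ (Finsupp.single ⟨1, hc.one_mem⟩ 1) with hb
  have hsingle : ∀ n k : c.sites, L n (Finsupp.single k 1) = b := by
    intro n k
    obtain ⟨i, hi, rfl⟩ := hnat n
    obtain ⟨j, hj, rfl⟩ := hnat k
    rw [(hind i hi).1, (hind j hj).2.1]
  have hLsum : ∀ n u, L n u = b * u.sum fun _ a => a := by
    intro n u
    conv_lhs => rw [← u.sum_single]
    rw [Finsupp.sum, map_sum, Finsupp.sum, Finset.mul_sum]
    refine Finset.sum_congr rfl fun k _ => ?_
    rw [← hsingle n k, ← mul_one (u k), ← smul_eq_mul, ← Finsupp.smul_single, map_smul]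
    simp [mul_comm]
  have hf2 : f ⟨2, hc.two_mem⟩ = f ⟨1, hc.one_mem⟩ + σ := (hbond 1 le_rfl hc.two_mem).2.2
  -- The equation of the additional root at site `1`. Its part depending on `u` is `b` times a
  -- nonzero number; its constant part fixes `f` at site `1`, for `D` with the help of `f_2 = f_1 +
  -- σ`.
  have hend : (T ≠ .A → b = 0) ∧ endValue σ (f ⟨1, hc.one_mem⟩) T := by
    have hp := fun h => hconst 0 ⟨1, hc.one_mem⟩ h ⟨1, hc.one_mem⟩
    have he := hcoef hu₀ ⟨1, hc.one_mem⟩ 0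
    simp only [hLsum, hc.pair_zero, rootOn_apply, hc.root_zero] at hp he
    cases T with
    | A => exact ⟨fun h => absurd rfl h, trivial⟩
    | B =>
      simp [endRoot] at hp
      refine ⟨fun _ => hp, ?_⟩
      simp [endRoot, hp] at he
      show _ = _
      linarith
    | C =>
      simp [endRoot] at hp
      refine ⟨fun _ => hp, ?_⟩
      simp [endRoot, hp] at he
      show _ = _
      linarith
    | D =>
      have hb0 : b = 0 := by
        have := hp (by simp [endRoot])
        simp at this
        linarith
      refine ⟨fun _ => hb0, ?_⟩
      simp [endRoot, hb0, hf2] at he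
      show _ = _
      linarith
  refine ⟨⟨b, hend.1, hLsum⟩, fun u hu n => ?_, fun n => ?_, hend.2⟩
  -- By the coefficient equations `L n` vanishes on every root that does not involve `n`, so the
  -- series is a finite sum and cancels term by term.
  · rw [heq u hu n, tsum_eq_sum (s := near n), ← Finset.sum_sub_distrib]
    · refine Finset.sum_eq_zero fun m _ => ?_
      rw [hcoef hu n m]
      ring
    · intro m hm
      rw [hcoef hu n m, rootOn_apply, root_apply_eq_zero hm]
      ring
  · obtain ⟨k, hk, rfl⟩ := hnat n
    rw [(hind k hk).2.2]
    push_cast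
    ring

/-! ### Affine substitutions and functions of one variable -/

section Slice

variable {X Y : Type*} [AddCommGroup X] [Module ℝ X] [AddCommGroup Y] [Module ℝ Y]

lemma SliceSmoothAt.comp_affine {g : X → ℝ} {k : X} {l : Y →ₗ[ℝ] X} {w : Y}
    (hg : SliceSmoothAt g (k + l w)) : SliceSmoothAt (fun w => g (k + l w)) w := by
  intro V _ _ _ A
  simpa [add_assoc] using hg V (l ∘ₗ A)

lemma lineDeriv_comp_affine (g : X → ℝ) (k : X) (l : Y →ₗ[ℝ] X) (w v : Y) :
    lineDeriv ℝ (fun w => g (k + l w)) w v = lineDeriv ℝ g (k + l w) (l v) := by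
  simp [lineDeriv, add_assoc]

lemma SliceSmoothAt.contDiffAt {g : ℝ → ℝ} {x : ℝ} (hg : SliceSmoothAt g x) :
    ContDiffAt ℝ ∞ g x := by
  have h := hg ℝ LinearMap.id
  have h2 : ContDiffAt ℝ ∞ (fun y : ℝ => y - x) x := contDiffAt_id.sub contDiffAt_const
  have h3 : ContDiffAt ℝ ∞ (fun a => g (x + LinearMap.id (R := ℝ) a)) (x - x) := by
    rwa [sub_self]
  have := ContDiffAt.comp (f := fun y : ℝ => y - x) x h3 h2
  simpa [Function.comp_def] using this

lemma lineDeriv_one (g : ℝ → ℝ) (x : ℝ) : lineDeriv ℝ g x 1 = deriv g x := by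
  simp only [lineDeriv, smul_eq_mul, mul_one]
  rw [deriv_comp_const_add, add_zero]

lemma SliceSmoothAt.contDiffAt_deriv {g : ℝ → ℝ} {x : ℝ} (hg : SliceSmoothAt g x) :
    ContDiffAt ℝ ∞ (deriv g) x := by
  have := (hg.lineDeriv 1).contDiffAt
  simpa only [lineDeriv_one] using this

end Slice

/-- The derivative along the first factor does not depend on the second one if the function is
the sum of a function of the first and a function of the second factor. -/
lemma lineDeriv_fst_eq {B E : Type*} [AddCommGroup B] [Module ℝ B] [AddCommGroup E] [Module ℝ E]
    {D : Set (B × E)} (hD : SliceOpen D) {g : B × E → ℝ} {u u₀ : E} {C : ℝ}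
    (h : ∀ b, (b, u) ∈ D → (b, u₀) ∈ D → g (b, u) = g (b, u₀) + C) {b : B} (hb : (b, u) ∈ D)
    (hb₀ : (b, u₀) ∈ D) (v : B) : lineDeriv ℝ g (b, u) (v, 0) = lineDeriv ℝ g (b, u₀) (v, 0) := by
  rw [lineDeriv, lineDeriv, ← deriv_add_const (f := fun t : ℝ => g ((b, u₀) + t • (v, 0))) C]
  refine Filter.EventuallyEq.deriv_eq ?_
  filter_upwards [hD.eventually_line hb (v, 0), hD.eventually_line hb₀ (v, 0)] with s h1 h2
  simp only [Prod.smul_mk, smul_zero, Prod.mk_add_mk, add_zero] at h1 h2 ⊢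
  exact h _ h1 h2

/-- The general element `X + V + c Z` on an arbitrary chain. -/
noncomputable def FieldParams.on (P : FieldParams) (c : Chain) : FieldVF c where
  ξ x _ _ := P.ξ x
  η _ y _ := P.η y
  φ n x y u := (deriv P.ξ x + deriv P.η y) * ((n : ℤ) : ℝ) + (P.β x + P.γ y)
    + P.c * u.sum fun _ a => a

/-! ### Symmetries of field theories with a left end: the determining equations and their solution
-/

section FieldForward

variable {c : Chain} {I J : Set ℝ} {U : ℤ → Set ℝ} {v : FieldVF c}

lemma FieldVF.derivForce_eq (v : FieldVF c) (n : c.sites) (x y : ℝ) (u : c.Config) :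
    v.derivForce n x y u = -∑ m ∈ near n, c.rootOn m n * c.expo m u *
      pair (c.rootOn m) fun l => v.φ l x y u :=
  finsum_mul_deriv_force n u fun l => v.φ l x y u

/-- The jet `u_{n,xx}` enters the prolongation only through `-(D_y ξ) u_{n,xx}`; its values `0` and
`1` are compared. The same works for `η` with `u_{n,yy}`. -/
lemma FieldVF.IsSymmetry.totalY_ξ (hv : v.IsSymmetry I J U) (n : c.sites) {x y : ℝ} (hx : x ∈ I)
    (hy : y ∈ J) {u : c.Config} (hu : c.InBox U u) (q : c.Config) : totalY v.ξ x y u q = 0 := by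
  have h0 := hv.annihilates x hx y hy u hu 0 q 0 0 n
  have h1 := hv.annihilates x hx y hy u hu 0 q (Finsupp.single n 1) 0 n
  rw [← h0] at h1
  simpa [FieldVF.prolongXY] using h1

lemma FieldVF.IsSymmetry.totalX_η (hv : v.IsSymmetry I J U) (n : c.sites) {x y : ℝ} (hx : x ∈ I)
    (hy : y ∈ J) {u : c.Config} (hu : c.InBox U u) (p : c.Config) : totalX v.η x y u p = 0 := by
  have h0 := hv.annihilates x hx y hy u hu p 0 0 0 n
  have h1 := hv.annihilates x hx y hy u hu p 0 0 (Finsupp.single n 1) n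
  rw [← h0] at h1
  simpa [FieldVF.prolongXY] using h1

/-- The choice `q = 0` disposes of the direction `(e, 0)`, and subtracting it from `(e, q)` disposes
of `(0, q)`. -/
lemma lineDeriv_eq_zero_of_dir {D : Set ((ℝ × ℝ) × c.Config)} {g : (ℝ × ℝ) × c.Config → ℝ}
    (hg : ∀ z ∈ D, SliceSmoothAt g z) {e : ℝ × ℝ}
    (h : ∀ z ∈ D, ∀ q, lineDeriv ℝ g z (e, q) = 0) {z : (ℝ × ℝ) × c.Config} (hz : z ∈ D) (a : ℝ)
    (q : c.Config) : lineDeriv ℝ g z (a • e, q) = 0 := by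
  have e1 : ((a • e, q) : (ℝ × ℝ) × c.Config) = a • (e, 0) + ((e, q) + (-1 : ℝ) • (e, 0)) := by
    ext <;> simp
  rw [e1, (hg z hz).lineDeriv_add, (hg z hz).lineDeriv_add, lineDeriv_smul, lineDeriv_smul,
    h z hz, h z hz]
  simp

theorem FieldVF.IsSymmetry.exists_params {T : Series} (hc : c.IsLeftEnded T)
    (hI : IsOpenInterval I) (hJ : IsOpenInterval J) (hU : ∀ n, IsOpenInterval (U n))
    (hne : ∃ u, c.InBox U u) (hv : v.IsSymmetry I J U) :
    ∃ P : FieldParams, P.Smooth I J ∧ P.Survives I J T ∧ v.EqOn I J U (P.on c) := by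
  obtain ⟨u₀, hu₀⟩ := hne
  obtain ⟨x₀, hx₀⟩ := hI.2.2
  obtain ⟨y₀, hy₀⟩ := hJ.2.2
  have hUo : ∀ n, IsOpen (U n) := fun n => (hU n).1
  set D := boxDomain c (I ×ˢ J) U with hD
  have hmem : ∀ {x y u}, x ∈ I → y ∈ J → c.InBox U u → ((x, y), u) ∈ D :=
    fun hx hy hu => ⟨⟨hx, hy⟩, hu⟩
  have hconv : Convex ℝ D := convex_boxDomain (hI.convex.prod hJ.convex) fun n => (hU n).2.1
  have hopen : SliceOpen D := sliceOpen_boxDomain (hI.1.prod hJ.1) hUo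
  have hξs : ∀ z ∈ D, SliceSmoothAt (uncurry₃ v.ξ) z := fun z hz =>
    hv.smooth_ξ.sliceSmoothAt hI.1 hJ.1 hUo hz
  have hηs : ∀ z ∈ D, SliceSmoothAt (uncurry₃ v.η) z := fun z hz =>
    hv.smooth_η.sliceSmoothAt hI.1 hJ.1 hUo hz
  have hφs : ∀ n, ∀ z ∈ D, SliceSmoothAt (uncurry₃ (v.φ n)) z := fun n z hz =>
    (hv.smooth_φ n).sliceSmoothAt hI.1 hJ.1 hUo hz
  -- the coefficients of `∂_x` and `∂_y`
  have hξ0 : ∀ z ∈ D, ∀ q, lineDeriv ℝ (uncurry₃ v.ξ) z ((0, 1), q) = 0 := fun z hz q =>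
    (totalY_eq _ _ _ _ _).symm.trans (hv.totalY_ξ ⟨1, hc.one_mem⟩ hz.1.1 hz.1.2 hz.2 q)
  have hη0 : ∀ z ∈ D, ∀ p, lineDeriv ℝ (uncurry₃ v.η) z ((1, 0), p) = 0 := fun z hz p =>
    (totalX_eq _ _ _ _ _).symm.trans (hv.totalX_η ⟨1, hc.one_mem⟩ hz.1.1 hz.1.2 hz.2 p)
  have hξ : ∀ {x y u}, x ∈ I → y ∈ J → c.InBox U u → v.ξ x y u = v.ξ x y₀ u₀ := by
    intro x y u hx hy hu
    refine eq_of_lineDeriv_eq_zero hconv hξs (hmem hx hy₀ hu₀) (hmem hx hy hu) fun z hz => ?_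
    have := lineDeriv_eq_zero_of_dir hξs hξ0 hz (y - y₀) (u - u₀)
    simpa using this
  have hη : ∀ {x y u}, x ∈ I → y ∈ J → c.InBox U u → v.η x y u = v.η x₀ y u₀ := by
    intro x y u hx hy hu
    refine eq_of_lineDeriv_eq_zero hconv hηs (hmem hx₀ hy hu₀) (hmem hx hy hu) fun z hz => ?_
    have := lineDeriv_eq_zero_of_dir hηs hη0 hz (x - x₀) (u - u₀)
    simpa using this
  set Ξ : ℝ → ℝ := fun x => v.ξ x y₀ u₀ with hΞ
  set Η : ℝ → ℝ := fun y => v.η x₀ y u₀ with hΗ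
  have hξX : ∀ z ∈ D, ∀ p, lineDeriv ℝ (uncurry₃ v.ξ) z ((1, 0), p) = deriv Ξ z.1.1 := by
    intro z hz p
    rw [lineDeriv_congr_on (g := uncurry₃ v.ξ) (h := fun z => Ξ z.1.1) hopen hz
      (fun w hw => hξ hw.1.1 hw.1.2 hw.2), ← lineDeriv_one]
    rfl
  have hηY : ∀ z ∈ D, ∀ p, lineDeriv ℝ (uncurry₃ v.η) z ((0, 1), p) = deriv Η z.1.2 := by
    intro z hz p
    rw [lineDeriv_congr_on (g := uncurry₃ v.η) (h := fun z => Η z.1.2) hopen hz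
      (fun w hw => hη hw.1.1 hw.1.2 hw.2), ← lineDeriv_one]
    rfl
  have hξXY : ∀ {x y u}, x ∈ I → y ∈ J → c.InBox U u → ∀ p q, totalXY v.ξ x y u p q = 0 := by
    intro x y u hx hy hu p q
    rw [totalXY_eq, lineDeriv_congr_on (h := fun _ => 0) hopen (hmem hx hy hu)
      (fun w hw => hξ0 w hw q), forceDeriv_eq_zero]
    · simp [lineDeriv]
    · intro w
      rw [lineDeriv_uncurry₃]
      simpa using lineDeriv_eq_zero_of_dir hξs hξ0 (hmem hx hy hu) 0 w
  have hηXY : ∀ {x y u}, x ∈ I → y ∈ J → c.InBox U u → ∀ p q, totalXY v.η x y u p q = 0 := by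
    intro x y u hx hy hu p q
    rw [totalXY_eq, (hηs _ (hmem hx hy hu)).lineDeriv_comm, lineDeriv_congr_on (h := fun _ => 0)
      hopen (hmem hx hy hu) (fun w hw => hη0 w hw p), forceDeriv_eq_zero]
    · simp [lineDeriv]
    · intro w
      rw [lineDeriv_uncurry₃]
      simpa using lineDeriv_eq_zero_of_dir hηs hη0 (hmem hx hy hu) 0 w
  -- the determining equations of the vertical part
  have hdet : ∀ {x y u}, x ∈ I → y ∈ J → c.InBox U u → ∀ p q n,
      lineDeriv ℝ (fun w => lineDeriv ℝ (uncurry₃ (v.φ n)) w ((0, 1), q)) ((x, y), u)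
        ((1, 0), p) + c.forceDeriv (v.φ n x y) u - (deriv Ξ x + deriv Η y) * c.force n u =
      v.derivForce n x y u := by
    intro x y u hx hy hu p q n
    rw [← hv.annihilates x hx y hy u hu p q 0 0 n, FieldVF.prolongXY, totalXY_eq,
      hξXY hx hy hu, hηXY hx hy hu, totalX_eq, totalY_eq v.η]
    rw [hξX _ (hmem hx hy hu) p, hηY _ (hmem hx hy hu) q]
    simp
    ring
  -- In `hdet` only the second-derivative term depends on the jets `p` and `q`.
  have hM : ∀ n, ∀ z ∈ D, ∀ p q,
      lineDeriv ℝ (fun w => lineDeriv ℝ (uncurry₃ (v.φ n)) w ((0, 1), q)) z ((1, 0), p) =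
      lineDeriv ℝ (fun w => lineDeriv ℝ (uncurry₃ (v.φ n)) w ((0, 1), 0)) z ((1, 0), 0) := by
    intro n z hz p q
    have h1 := hdet hz.1.1 hz.1.2 hz.2 p q n
    have h2 := hdet hz.1.1 hz.1.2 hz.2 0 0 n
    linarith
  have hL : ∀ n, ∃ L : c.Config →ₗ[ℝ] ℝ,
      (∀ z ∈ D, ∀ p, lineDeriv ℝ (uncurry₃ (v.φ n)) z (0, p) = L p) ∧
      ∀ b u u₀, (b, u) ∈ D → (b, u₀) ∈ D →
        uncurry₃ (v.φ n) (b, u) = uncurry₃ (v.φ n) (b, u₀) + L (u - u₀) := by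
    intro n
    refine exists_linear_of_lineDeriv_const hconv (hφs n) ⟨_, hmem hx₀ hy₀ hu₀⟩
      fun z hz p w => ?_
    have hs := hφs n z hz
    have s1 : ∀ e : ℝ × ℝ, ∀ q : c.Config, ((e, q) : (ℝ × ℝ) × c.Config) = (e, 0) + (0, q) :=
      fun e q => by simp
    -- The parts of `hM` linear in one jet give `φ_{xu} = 0` and `φ_{yu} = 0`; its bilinear part
    -- then gives `φ_{uu} = 0`. Hence the derivative of `φ_n` in `u` is constant on the box.
    have d1 : lineDeriv ℝ (fun x => lineDeriv ℝ (uncurry₃ (v.φ n)) x (0, p)) z ((1, 0), 0) = 0 := by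
      have := hM n z hz 0 p
      rw [s1 (0, 1) p, hs.lineDeriv_lineDeriv_add] at this
      linarith
    have d2 : ∀ q, lineDeriv ℝ (fun x => lineDeriv ℝ (uncurry₃ (v.φ n)) x (0, q)) z
        ((0, 1), 0) = 0 := by
      intro q
      have := hM n z hz q 0
      rw [s1 (1, 0) q, (hs.lineDeriv _).lineDeriv_add, hs.lineDeriv_comm _ (0, q)] at this
      linarith
    have d3 : ∀ q, lineDeriv ℝ (fun x => lineDeriv ℝ (uncurry₃ (v.φ n)) x (0, p)) z
        (0, q) = 0 := by
      intro q
      have := hM n z hz q p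
      rw [s1 (0, 1) p, hs.lineDeriv_lineDeriv_add, s1 (1, 0) q, (hs.lineDeriv _).lineDeriv_add,
        (hs.lineDeriv _).lineDeriv_add, hs.lineDeriv_comm ((0, 1), 0) (0, q), d2, d1] at this
      linarith
    have s2 : w = w.1.1 • ((1, 0), 0) + (w.1.2 • ((0, 1), 0) + (0, w.2)) := by
      ext <;> simp
    rw [s2, (hs.lineDeriv _).lineDeriv_add, (hs.lineDeriv _).lineDeriv_add, lineDeriv_smul,
      lineDeriv_smul, d1, d2, d3]
    simp
  choose L hL1 hL2 using hL
  -- This is `φ_{n,xy}`. It does not depend on `u`, because `u` contributes only an additive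
  -- constant for fixed `u`.
  set K : c.sites → ℝ → ℝ → ℝ := fun n x y =>
    lineDeriv ℝ (fun w => lineDeriv ℝ (uncurry₃ (v.φ n)) w ((0, 1), 0)) ((x, y), u₀) ((1, 0), 0)
    with hK
  have hKu : ∀ n {x y u}, x ∈ I → y ∈ J → c.InBox U u →
      lineDeriv ℝ (fun w => lineDeriv ℝ (uncurry₃ (v.φ n)) w ((0, 1), 0)) ((x, y), u)
        ((1, 0), 0) = K n x y := by
    intro n x y u hx hy hu
    refine lineDeriv_fst_eq hopen (C := 0) (fun b hb hb₀ => ?_) (hmem hx hy hu)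
      (hmem hx hy hu₀) _
    rw [add_zero]
    exact lineDeriv_fst_eq hopen (fun b hb hb₀ => hL2 n b _ _ hb hb₀) hb hb₀ _
  have hforce : ∀ n {x y u}, x ∈ I → y ∈ J → c.InBox U u → ∀ m,
      c.forceTerm (v.φ n x y) u m = -(c.expo m u * L n (c.rootOn m)) := by
    intro n x y u hx hy hu m
    rw [forceTerm_eq, lineDeriv_uncurry₃,
      hL1 n _ (hmem hx hy hu), map_neg]
    ring
  set f : c.sites → ℝ → ℝ → ℝ := fun n x y => v.φ n x y u₀ - L n u₀ with hf
  have hφ : ∀ n {x y u}, x ∈ I → y ∈ J → c.InBox U u → v.φ n x y u = L n u + f n x y := by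
    intro n x y u hx hy hu
    have := hL2 n (x, y) u u₀ (hmem hx hy hu) (hmem hx hy hu₀)
    rw [map_sub] at this
    simp only [uncurry₃] at this
    rw [this, hf]
    ring
  -- At each fixed point `(x, y)` the determining equations have the form treated by `solve`, with
  -- `Λ = 0` and `κ = φ_{n,xy}`.
  have hsolve : ∀ {x y}, x ∈ I → y ∈ J → _ := fun {x y} hx hy =>
    hc.solve (L := L) (Λ := fun _ => 0) (f := fun n => f n x y) (κ := fun n => K n x y)
      (σ := deriv Ξ x + deriv Η y) hUo ⟨u₀, hu₀⟩
      (fun u hu n => by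
        have := (hv.summable_φ n x hx y hy u hu).neg
        simpa [hforce n hx hy hu] using this)
      (fun u hu n => by
        have h1 := hdet hx hy hu 0 0 n
        rw [hKu n hx hy hu, Chain.forceDeriv, tsum_congr (hforce n hx hy hu), tsum_neg,
          force_eq, FieldVF.derivForce_eq] at h1
        simp only [hφ _ hx hy hu] at h1
        have h2 : ∑ m ∈ near n, c.rootOn m n * c.expo m u * (deriv Ξ x + deriv Η y +
            pair (c.rootOn m) fun l => L l u + f l x y) = (deriv Ξ x + deriv Η y) *
            ∑ m ∈ near n, c.rootOn m n * c.expo m u + ∑ m ∈ near n, c.rootOn m n *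
            c.expo m u * pair (c.rootOn m) fun l => L l u + f l x y := by
          rw [Finset.mul_sum, ← Finset.sum_add_distrib]
          exact Finset.sum_congr rfl fun _ _ => by ring
        rw [h2, LinearMap.zero_apply]
        linarith)
  obtain ⟨⟨b, hbT, hb⟩, -⟩ := hsolve hx₀ hy₀
  have hKz : ∀ {x y}, x ∈ I → y ∈ J → ∀ n, K n x y = 0 := fun hx hy n => by
    simpa using (hsolve hx hy).2.1 u₀ hu₀ n
  set o : c.sites := ⟨1, hc.one_mem⟩ with ho
  have hfn : ∀ n {x y}, x ∈ I → y ∈ J → f n x y = f o x y +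
      (deriv Ξ x + deriv Η y) * (((n : ℤ) : ℝ) - 1) := fun n _ _ hx hy =>
    (hsolve hx hy).2.2.1 n
  -- separation of the variables `x` and `y`
  have hsep : ∀ {x y}, x ∈ I → y ∈ J → f o x y = f o x y₀ + f o x₀ y - f o x₀ y₀ := by
    intro x y hx hy
    let l : ℝ →ₗ[ℝ] (ℝ × ℝ) × c.Config := LinearMap.inl ℝ (ℝ × ℝ) c.Config ∘ₗ LinearMap.inr ℝ ℝ ℝ
    have hl : ∀ x y : ℝ, (((x, 0), u₀) : (ℝ × ℝ) × c.Config) + l y = ((x, y), u₀) := fun x y => by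
      simp [l]
    have hs : ∀ x ∈ I, ∀ y ∈ J, SliceSmoothAt (fun y => uncurry₃ (v.φ o)
        (((x, 0), u₀) + l y)) y := fun x hx y hy =>
      SliceSmoothAt.comp_affine (by rw [hl]; exact hφs o _ (hmem hx hy hu₀))
    -- Since `φ_{1,xy} = 0`, the derivative in `y` at site `1` is the same for `x` and `x₀`.
    have hdy : ∀ y ∈ J, lineDeriv ℝ (uncurry₃ (v.φ o)) ((x, y), u₀) ((0, 1), 0) =
        lineDeriv ℝ (uncurry₃ (v.φ o)) ((x₀, y), u₀) ((0, 1), 0) := by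
      intro y hy
      refine eq_of_lineDeriv_eq_zero
        (g := fun z => lineDeriv ℝ (uncurry₃ (v.φ o)) z ((0, 1), 0)) hconv
        (fun z hz => (hφs o z hz).lineDeriv _) (hmem hx₀ hy hu₀) (hmem hx hy hu₀) fun z hz => ?_
      have e : ((x, y), u₀) - ((x₀, y), u₀) =
        (x - x₀) • (((1, 0), 0) : (ℝ × ℝ) × c.Config) := by simp
      rw [e, lineDeriv_smul, hKu o hz.1.1 hz.1.2 hz.2, hKz hz.1.1 hz.1.2, smul_zero]
    have h1 := eq_of_lineDeriv_eq_zero hJ.convex (g := fun y =>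
      uncurry₃ (v.φ o) (((x, 0), u₀) + l y) - uncurry₃ (v.φ o) (((x₀, 0), u₀) + l y))
      (fun y hy => (hs x hx y hy).sub (hs x₀ hx₀ y hy)) hy₀ hy (fun y' hy' => by
        have e : y - y₀ = (y - y₀) • (1 : ℝ) := by simp
        rw [lineDeriv_sub_fun (hs x hx y' hy') (hs x₀ hx₀ y' hy'), lineDeriv_comp_affine,
          lineDeriv_comp_affine, hl, hl, e, map_smul, lineDeriv_smul, lineDeriv_smul]
        have e1 : l 1 = ((0, 1), 0) := by simp [l]
        rw [e1, hdy y' hy', sub_self])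
    simp only [hl, uncurry₃] at h1
    simp only [hf]
    linarith
  have hsx : ∀ {g : ℝ → ℝ → c.Config → ℝ}, (∀ z ∈ D, SliceSmoothAt (uncurry₃ g) z) →
      ∀ x ∈ I, SliceSmoothAt (fun x => g x y₀ u₀) x := by
    intro g hg x hx
    have := SliceSmoothAt.comp_affine (g := uncurry₃ g) (k := ((0, y₀), u₀))
      (l := LinearMap.inl ℝ (ℝ × ℝ) c.Config ∘ₗ LinearMap.inl ℝ ℝ ℝ) (w := x)
      (by simpa using hg _ (hmem hx hy₀ hu₀))
    simpa [uncurry₃] using this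
  have hsy : ∀ {g : ℝ → ℝ → c.Config → ℝ}, (∀ z ∈ D, SliceSmoothAt (uncurry₃ g) z) →
      ∀ y ∈ J, SliceSmoothAt (fun y => g x₀ y u₀) y := by
    intro g hg y hy
    have := SliceSmoothAt.comp_affine (g := uncurry₃ g) (k := ((x₀, 0), u₀))
      (l := LinearMap.inl ℝ (ℝ × ℝ) c.Config ∘ₗ LinearMap.inr ℝ ℝ ℝ) (w := y)
      (by simpa using hg _ (hmem hx₀ hy hu₀))
    simpa [uncurry₃] using this
  -- Passing from `f_1 + σ (n - 1)` to `σ n + (β + γ)` shifts the constant by `-σ = -(ξ' + η')`,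
  -- shared out as `-ξ'` to `β` and `-η'` to `γ`.
  have hβγ : ∀ {x y}, x ∈ I → y ∈ J → (f o x y₀ - f o x₀ y₀ - deriv Ξ x) +
      (f o x₀ y - deriv Η y) = f o x y - (deriv Ξ x + deriv Η y) := by
    intro x y hx hy
    rw [hsep hx hy]
    ring
  refine ⟨⟨Ξ, Η, fun x => f o x y₀ - f o x₀ y₀ - deriv Ξ x, fun y => f o x₀ y - deriv Η y, b⟩,
    ⟨fun x hx => ?_, fun y hy => ?_, fun x hx => ?_, fun y hy => ?_⟩, ?_, fun x hx y hy u hu =>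
      ⟨hξ hx hy hu, hη hx hy hu, fun n => ?_⟩⟩
  · exact (hsx hξs x hx).contDiffAt.contDiffWithinAt
  · exact (hsy hηs y hy).contDiffAt.contDiffWithinAt
  · exact ((((hsx (hφs o) x hx).contDiffAt.sub contDiffAt_const).sub contDiffAt_const).sub
      (hsx hξs x hx).contDiffAt_deriv).contDiffWithinAt
  · exact (((hsy (hφs o) y hy).contDiffAt.sub contDiffAt_const).sub
      (hsy hηs y hy).contDiffAt_deriv).contDiffWithinAt
  · have hend := fun {x y} (hx : x ∈ I) (hy : y ∈ J) => (hsolve hx hy).2.2.2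
    cases T with
    | A => trivial
    | B =>
      refine ⟨hbT (by simp), fun x hx y hy => (hβγ hx hy).trans ?_⟩
      have : f o x y = deriv Ξ x + deriv Η y := hend hx hy
      rw [this, sub_self]
    | C =>
      refine ⟨hbT (by simp), fun x hx y hy => (hβγ hx hy).trans ?_⟩
      have : 2 * f o x y = deriv Ξ x + deriv Η y := hend hx hy
      simp only
      linarith
    | D =>
      refine ⟨hbT (by simp), fun x hx y hy => (hβγ hx hy).trans ?_⟩
      have : f o x y = 0 := hend hx hy
      rw [this, zero_sub]
  · have h1 := hβγ hx hy
    simp only [FieldParams.on]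
    rw [h1, hφ n hx hy hu, hb, hfn n hx hy]
    ring

end FieldForward

/-- The general element `p P + d D + a U + b W + c Z` on an arbitrary chain. -/
noncomputable def LatticeParams.on (P : LatticeParams) (c : Chain) : LatticeVF c where
  τ t _ := P.p + P.d * t
  φ n t u := 2 * P.d * ((n : ℤ) : ℝ) + P.a + P.b * t + P.c * u.sum fun _ a => a

lemma affine_of_deriv_eq {I : Set ℝ} (hI : Convex ℝ I) {g : ℝ → ℝ}
    (hg : ∀ t ∈ I, SliceSmoothAt g t) {d : ℝ} (hd : ∀ t ∈ I, deriv g t = d) {t₀ t : ℝ}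
    (ht₀ : t₀ ∈ I) (ht : t ∈ I) : g t = g t₀ + d * (t - t₀) := by
  have := eq_of_lineDeriv_eq_zero hI (g := fun s => g s - (d • (LinearMap.id : ℝ →ₗ[ℝ] ℝ)) s)
    (fun s hs => (hg s hs).sub (sliceSmoothAt_linear _ s)) ht₀ ht (fun s hs => by
      rw [lineDeriv_sub_fun (hg s hs) (sliceSmoothAt_linear _ s), lineDeriv_linear,
        ← mul_one (t - t₀), ← smul_eq_mul, lineDeriv_smul, lineDeriv_one, hd s hs]
      simp
      ring)
  simp at this
  linarith

/-- The variant of `lineDeriv_fst_eq` for a discrepancy `θ` depending on time; it serves for the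
term `θ'(t) u_n / 2` of a lattice symmetry. -/
lemma lineDeriv_fst_add {E : Type*} [AddCommGroup E] [Module ℝ E]
    {D : Set (ℝ × E)} (hD : SliceOpen D) {g : ℝ × E → ℝ} {u u₀ : E} {θ : ℝ → ℝ}
    (h : ∀ t, (t, u) ∈ D → (t, u₀) ∈ D → g (t, u) = g (t, u₀) + θ t) {t : ℝ} (ht : (t, u) ∈ D)
    (ht₀ : (t, u₀) ∈ D) (hg : SliceSmoothAt g (t, u₀)) (hθ : DifferentiableAt ℝ θ t) :
    lineDeriv ℝ g (t, u) (1, 0) = lineDeriv ℝ g (t, u₀) (1, 0) + deriv θ t := by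
  have h1 : HasDerivAt (fun s : ℝ => θ (t + s)) (deriv θ t) 0 := by
    have h2 : HasDerivAt θ (deriv θ t) (t + 0) := by rw [add_zero]; exact hθ.hasDerivAt
    exact h2.comp_const_add t 0
  have h3 := (hg.lineDifferentiableAt (1, 0)).hasLineDerivAt
  refine (HasDerivAt.congr_of_eventuallyEq (HasDerivAt.add h3 h1) ?_).deriv
  filter_upwards [hD.eventually_line ht (1, 0), hD.eventually_line ht₀ (1, 0)] with s h1 h2
  simp only [Prod.smul_mk, smul_zero, Prod.mk_add_mk, add_zero, smul_eq_mul, mul_one] at h1 h2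
  simpa using h _ h1 h2

/-! ### Symmetries of lattices with a left end: the determining equations and their solution -/

section LatticeForward

variable {c : Chain} {I : Set ℝ} {U : ℤ → Set ℝ} {v : LatticeVF c}

lemma LatticeVF.derivForce_eq (v : LatticeVF c) (n : c.sites) (t : ℝ) (u : c.Config) :
    v.derivForce n t u = -∑ m ∈ near n, c.rootOn m n * c.expo m u *
      pair (c.rootOn m) fun l => v.φ l t u :=
  finsum_mul_deriv_force n u fun l => v.φ l t u

/-- The plain product of neighbouring entries has no fixed sign: it is `-1` on bond `j` but `1` on
the additional root of `D` at the sites `1`, `2`. With one entry squared the sign is fixed, since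
the additional roots have no positive entries and a bond can have both entries nonzero only for `m =
j`. -/
lemma Chain.IsLeftEnded.root_sq_mul_nonpos {T : Series} (hc : c.IsLeftEnded T) (m j : ℤ) :
    c.root m j ^ 2 * c.root m (j + 1) ≤ 0 := by
  by_cases h0 : m = 0
  · have : c.root m (j + 1) ≤ 0 := by
      rw [h0, hc.root_zero]
      cases T <;> simp [endRoot, Finsupp.single_apply] <;> split_ifs <;> norm_num
    nlinarith [sq_nonneg (c.root m j)]
  by_cases h : 1 ≤ m ∧ m + 1 ∈ c.sites
  · rw [hc.root_bond m h.1 h.2, bond_apply, bond_apply]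
    by_cases h1 : m = j + 1
    · rw [if_neg (show m ≠ j by omega), if_neg (show m + 1 ≠ j by omega)]
      simp
    · rw [if_neg h1]
      split_ifs <;> norm_num
  · simp [hc.root_other m h0 h]

lemma hasLineDerivAt_expo_sum (F : Finset ℤ) (a : ℤ → ℝ) (u w : c.Config) :
    HasDerivAt (fun s : ℝ => ∑ m ∈ F, a m * c.expo m (u + s • w))
      (∑ m ∈ F, a m * pair (c.rootOn m) w * c.expo m u) 0 := by
  refine (HasDerivAt.fun_sum fun m _ => (hasDerivAt_expo m u w).const_mul (a m)).congr_deriv ?_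
  exact Finset.sum_congr rfl fun _ _ => by ring

/-- The determining equations of a lattice, sorted by the powers of `u_t`. -/
lemma LatticeVF.IsSymmetry.determining (hv : v.IsSymmetry I U) {t : ℝ} {u : c.Config}
    (ht : t ∈ I) (hu : c.InBox U u) (hτ : SliceSmoothAt (uncurry₂ v.τ) (t, u))
    (hφ : ∀ n, SliceSmoothAt (uncurry₂ (v.φ n)) (t, u)) (p : c.Config) (n : c.sites) :
    lineDeriv ℝ (fun w => lineDeriv ℝ (uncurry₂ v.τ) w (0, p)) (t, u) (0, p) * p n = 0 ∧
    lineDeriv ℝ (fun w => lineDeriv ℝ (uncurry₂ (v.φ n)) w (0, p)) (t, u) (0, p) =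
      2 * lineDeriv ℝ (fun w => lineDeriv ℝ (uncurry₂ v.τ) w (0, p)) (t, u) (1, 0) * p n ∧
    2 * lineDeriv ℝ (fun w => lineDeriv ℝ (uncurry₂ (v.φ n)) w (0, p)) (t, u) (1, 0) =
      (lineDeriv ℝ (fun w => lineDeriv ℝ (uncurry₂ v.τ) w (1, 0)) (t, u) (1, 0) +
        c.forceDeriv (v.τ t) u) * p n +
      2 * lineDeriv ℝ (uncurry₂ v.τ) (t, u) (0, p) * c.force n u ∧
    lineDeriv ℝ (fun w => lineDeriv ℝ (uncurry₂ (v.φ n)) w (1, 0)) (t, u) (1, 0) +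
      c.forceDeriv (v.φ n t) u - 2 * lineDeriv ℝ (uncurry₂ v.τ) (t, u) (1, 0) * c.force n u =
      v.derivForce n t u := by
  have hs : ∀ r : ℝ, ((1, r • p) : ℝ × c.Config) = (1, 0) + r • (0, p) := fun r => by simp
  have hexp : ∀ {g : ℝ × c.Config → ℝ}, SliceSmoothAt g (t, u) → ∀ r : ℝ,
      lineDeriv ℝ (fun w => lineDeriv ℝ g w (1, r • p)) (t, u) (1, r • p) =
      lineDeriv ℝ (fun w => lineDeriv ℝ g w (1, 0)) (t, u) (1, 0) +
        2 * r * lineDeriv ℝ (fun w => lineDeriv ℝ g w (0, p)) (t, u) (1, 0) +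
        r ^ 2 * lineDeriv ℝ (fun w => lineDeriv ℝ g w (0, p)) (t, u) (0, p) := by
    intro g hg r
    rw [hs, hg.lineDeriv_lineDeriv_add, hg.lineDeriv_lineDeriv_smul,
      (hg.lineDeriv _).lineDeriv_add, (hg.lineDeriv _).lineDeriv_add, lineDeriv_smul,
      lineDeriv_smul, hg.lineDeriv_comm (1, 0) (0, p), smul_eq_mul, smul_eq_mul]
    ring
  have key : ∀ r : ℝ, _ := fun r => by
    have h := hv.annihilates t ht u hu (r • p) n
    rw [LatticeVF.prolongTT, totalTT_eq, totalTT_eq, totalT_eq, hexp (hφ n), hexp hτ, hs,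
      hτ.lineDeriv_add, lineDeriv_smul, Finsupp.smul_apply, smul_eq_mul, smul_eq_mul] at h
    exact h
  -- The relation is a cubic polynomial in `r`; four values determine its coefficients.
  have k0 := key 0
  have k1 := key 1
  have k2 := key (-1)
  have k3 := key 2
  refine ⟨?_, ?_, ?_, ?_⟩ <;> linarith

theorem LatticeVF.IsSymmetry.exists_params {T : Series} (hc : c.IsLeftEnded T)
    (hI : IsOpenInterval I) (hU : ∀ n, IsOpenInterval (U n))
    (hne : ∃ u, c.InBox U u) (hv : v.IsSymmetry I U) :
    ∃ P : LatticeParams, P.Survives T ∧ v.EqOn I U (P.on c) := by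
  classical
  obtain ⟨u₀, hu₀⟩ := hne
  obtain ⟨t₀, ht₀⟩ := hI.2.2
  have hUo : ∀ n, IsOpen (U n) := fun n => (hU n).1
  set D := boxDomain c I U with hD
  have hmem : ∀ {t u}, t ∈ I → c.InBox U u → (t, u) ∈ D := fun ht hu => ⟨ht, hu⟩
  have hconv : Convex ℝ D := convex_boxDomain hI.convex fun n => (hU n).2.1
  have hopen : SliceOpen D := sliceOpen_boxDomain hI.1 hUo
  have hτs : ∀ z ∈ D, SliceSmoothAt (uncurry₂ v.τ) z := fun z hz =>
    hv.smooth_τ.sliceSmoothAt hI.1 hUo hz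
  have hφs : ∀ n, ∀ z ∈ D, SliceSmoothAt (uncurry₂ (v.φ n)) z := fun n z hz =>
    (hv.smooth_φ n).sliceSmoothAt hI.1 hUo hz
  have hdet := fun (z : ℝ × c.Config) (hz : z ∈ D) =>
    hv.determining hz.1 hz.2 (hτs z hz) (fun n => hφs n z hz)
  -- polarization
  have hpol : ∀ {g : ℝ × c.Config → ℝ} {z}, SliceSmoothAt g z →
      (∀ p, lineDeriv ℝ (fun w => lineDeriv ℝ g w (0, p)) z (0, p) = 0) →
      ∀ p q, lineDeriv ℝ (fun w => lineDeriv ℝ g w (0, p)) z (0, q) = 0 := by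
    intro g z hg h p q
    have e : ((0, p + q) : ℝ × c.Config) = (0, p) + (0, q) := by simp
    have h1 := h (p + q)
    rw [e, hg.lineDeriv_lineDeriv_add, (hg.lineDeriv _).lineDeriv_add,
      (hg.lineDeriv _).lineDeriv_add, h p, h q, hg.lineDeriv_comm (0, q) (0, p)] at h1
    linarith
  have hτ2 : ∀ z ∈ D, ∀ p q,
      lineDeriv ℝ (fun w => lineDeriv ℝ (uncurry₂ v.τ) w (0, p)) z (0, q) = 0 := by
    intro z hz
    refine hpol (hτs z hz) fun p => ?_
    by_cases hp : p = 0
    · subst hp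
      exact lineDeriv_zero
    · obtain ⟨n, hn⟩ := Finsupp.ne_iff.1 hp
      exact (mul_eq_zero.1 (hdet z hz p n).1).resolve_right hn
  -- the coefficient of `∂_t` does not depend on the fields
  have hτbond : ∀ j : ℤ, ∀ (h1 : 1 ≤ j) (h2 : j + 1 ∈ c.sites) (h3 : j ∈ c.sites)
      (k n : c.sites), (k = ⟨j, h3⟩ ∧ n = ⟨j + 1, h2⟩ ∨ k = ⟨j + 1, h2⟩ ∧ n = ⟨j, h3⟩) →
      ∀ z ∈ D, lineDeriv ℝ (uncurry₂ v.τ) z (0, Finsupp.single k 1) = 0 := by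
    intro j h1 h2 h3 k n hkn
    set p : c.Config := Finsupp.single k 1 with hp
    have hpn : p n = 0 := by
      rw [hp, Finsupp.single_apply, if_neg]
      rcases hkn with ⟨rfl, rfl⟩ | ⟨rfl, rfl⟩ <;> simp
    -- The jet is concentrated at the neighbour `k` of `n`, so all terms of the equation at `n` with
    -- the factor `p n` drop out.
    have hφpp : ∀ z ∈ D,
        lineDeriv ℝ (fun w => lineDeriv ℝ (uncurry₂ (v.φ n)) w (0, p)) z (0, p) = 0 := by
      intro z hz
      rw [(hdet z hz p n).2.1, hpn, mul_zero]
    have hφpt : ∀ z ∈ D,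
        lineDeriv ℝ (fun w => lineDeriv ℝ (uncurry₂ (v.φ n)) w (0, p)) z (1, 0) =
        lineDeriv ℝ (uncurry₂ v.τ) z (0, p) * c.force n z.2 := by
      intro z hz
      have := (hdet z hz p n).2.2.1
      rw [hpn] at this
      linarith
    -- a derivative of a product with a sum of exponentials
    have hprod : ∀ z ∈ D, ∀ (w : c.Config) (a : ℤ → ℝ),
        lineDeriv ℝ (fun z => lineDeriv ℝ (uncurry₂ v.τ) z (0, p) *
          ∑ m ∈ near n, a m * c.expo m z.2) z (0, w) = lineDeriv ℝ (uncurry₂ v.τ) z (0, p) *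
          ∑ m ∈ near n, a m * pair (c.rootOn m) w * c.expo m z.2 := by
      intro z hz w a
      have d1 := (((hτs z hz).lineDeriv (0, p)).lineDifferentiableAt (0, w)).hasLineDerivAt
      rw [hτ2 z hz p w] at d1
      have d2 := HasDerivAt.fun_mul d1 (hasLineDerivAt_expo_sum (near n) a z.2 w)
      have d3 := d2.deriv
      simp only [zero_smul, zero_mul, add_zero, zero_add] at d3
      exact d3
    -- By symmetry of derivatives `0 = ∂_t φ_{pp} = ∂_p (τ_p F_n)`, which is `τ_p ∂_p F_n` because
    -- `τ_{pp} = 0`.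
    have hS1 : ∀ z ∈ D, lineDeriv ℝ (uncurry₂ v.τ) z (0, p) *
        ∑ m ∈ near n, c.rootOn m n * c.rootOn m k * c.expo m z.2 = 0 := by
      intro z hz
      have e1 : lineDeriv ℝ (fun z => lineDeriv ℝ (fun w => lineDeriv ℝ (uncurry₂ (v.φ n)) w (0, p))
          z (1, 0)) z (0, p) = 0 := by
        rw [((hφs n z hz).lineDeriv (0, p)).lineDeriv_comm,
          lineDeriv_congr_on (h := fun _ => 0) hopen hz (fun w hw => hφpp w hw)]
        simp [lineDeriv]
      rw [lineDeriv_congr_on hopen hz (fun w hw => hφpt w hw)] at e1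
      simp only [force_eq, ← Finset.sum_neg_distrib, ← neg_mul] at e1
      rw [hprod z hz p (fun m => -c.rootOn m n)] at e1
      simp only [hp, pair_single_right, neg_mul, Finset.sum_neg_distrib, mul_neg,
        neg_eq_zero] at e1
      exact e1
    intro z hz
    -- One more derivative, at site `j`, gives the exponentials coefficients of a common sign, with
    -- `-1` on bond `j`. The sum is then strictly negative and `τ_p = 0`.
    have e2 : lineDeriv ℝ (uncurry₂ v.τ) z (0, p) * ∑ m ∈ near n, c.rootOn m n * c.rootOn m k *
        c.rootOn m ⟨j, h3⟩ * c.expo m z.2 = 0 := by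
      have := hprod z hz (Finsupp.single ⟨j, h3⟩ 1) (fun m => c.rootOn m n * c.rootOn m k)
      simp only [pair_single_right] at this
      rw [← this, lineDeriv_congr_on (h := fun _ => 0) hopen hz (fun w hw => hS1 w hw)]
      simp [lineDeriv]
    refine (mul_eq_zero.1 e2).resolve_right (ne_of_lt ?_)
    have hterm : ∀ m, c.rootOn m n * c.rootOn m k * c.rootOn m ⟨j, h3⟩ =
        c.root m j ^ 2 * c.root m (j + 1) := by
      intro m
      rcases hkn with ⟨rfl, rfl⟩ | ⟨rfl, rfl⟩ <;> simp only [rootOn_apply] <;> ring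
    simp only [hterm]
    refine Finset.sum_neg' (fun m _ => ?_) ⟨j, ?_, ?_⟩
    · exact mul_nonpos_of_nonpos_of_nonneg (hc.root_sq_mul_nonpos m j) (expo_pos m _).le
    · rcases hkn with ⟨rfl, rfl⟩ | ⟨rfl, rfl⟩ <;> simp [near]
    · have : c.root j j ^ 2 * c.root j (j + 1) = -1 := by
        rw [hc.root_bond j h1 h2, bond_apply, bond_apply]
        simp
      rw [this]
      have := expo_pos j z.2
      linarith
  have hτk : ∀ k : c.sites, ∀ z ∈ D,
      lineDeriv ℝ (uncurry₂ v.τ) z (0, Finsupp.single k 1) = 0 := by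
    rintro ⟨k, hk⟩
    have h1 := hc.one_le k hk
    -- The last site of a finite chain has only a left neighbour, which exists because there are at
    -- least two sites.
    by_cases h2 : k + 1 ∈ c.sites
    · exact hτbond k h1 h2 hk _ ⟨k + 1, h2⟩ (Or.inl ⟨rfl, rfl⟩)
    · have h3 : 2 ≤ k := by
        by_contra h
        have : k = 1 := by omega
        subst this
        exact h2 hc.two_mem
      have h4 : k - 1 ∈ c.sites := hc.mem_of_le k hk _ (by omega) (by omega)
      exact hτbond (k - 1) (by omega) (by simpa using hk) h4 _ ⟨k - 1, h4⟩
        (Or.inr ⟨Subtype.ext (by simp), rfl⟩)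
  have hτ1 : ∀ z ∈ D, ∀ p, lineDeriv ℝ (uncurry₂ v.τ) z (0, p) = 0 := by
    intro z hz p
    have : (hτs z hz).lineDerivₗ ∘ₗ LinearMap.inr ℝ ℝ c.Config = 0 :=
      Finsupp.lhom_ext' fun k => LinearMap.ext_ring (hτk k z hz)
    exact LinearMap.congr_fun this p
  set θ : ℝ → ℝ := fun t => v.τ t u₀ with hθ
  have hτ : ∀ {t u}, t ∈ I → c.InBox U u → v.τ t u = θ t := by
    intro t u ht hu
    exact eq_of_lineDeriv_eq_zero hconv hτs (hmem ht hu₀) (hmem ht hu) fun z hz => by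
      simpa using hτ1 z hz (u - u₀)
  have hθs : ∀ {g : ℝ → c.Config → ℝ}, (∀ z ∈ D, SliceSmoothAt (uncurry₂ g) z) →
      ∀ t ∈ I, SliceSmoothAt (fun t => g t u₀) t := by
    intro g hg t ht
    have := SliceSmoothAt.comp_affine (g := uncurry₂ g) (k := (0, u₀))
      (l := LinearMap.inl ℝ ℝ c.Config) (w := t) (by simpa using hg _ (hmem ht hu₀))
    simpa [uncurry₂] using this
  have hderiv : ∀ {g : ℝ → ℝ}, (∀ t ∈ I, SliceSmoothAt g t) → ∀ t ∈ I, SliceSmoothAt (deriv g) t := by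
    intro g hg t ht
    have := (hg t ht).lineDeriv 1
    simpa only [lineDeriv_one] using this
  have hθ0 : ∀ t ∈ I, SliceSmoothAt θ t := hθs hτs
  have hθ1 := hderiv hθ0
  have hθ2 := hderiv hθ1
  have hT1 : ∀ z ∈ D, lineDeriv ℝ (uncurry₂ v.τ) z (1, 0) = deriv θ z.1 := by
    intro z hz
    rw [lineDeriv_congr_on (g := uncurry₂ v.τ) (h := fun z => θ z.1) hopen hz
      (fun w hw => hτ hw.1 hw.2), ← lineDeriv_one]
    rfl
  have hT2 : ∀ z ∈ D, lineDeriv ℝ (fun w => lineDeriv ℝ (uncurry₂ v.τ) w (1, 0)) z (1, 0) =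
      deriv (deriv θ) z.1 := by
    intro z hz
    rw [lineDeriv_congr_on hopen hz (fun w hw => hT1 w hw), ← lineDeriv_one (deriv θ)]
    rfl
  have hTp : ∀ z ∈ D, ∀ p, lineDeriv ℝ (fun w => lineDeriv ℝ (uncurry₂ v.τ) w (0, p)) z (1, 0) =
      0 := by
    intro z hz p
    rw [lineDeriv_congr_on (h := fun _ => 0) hopen hz (fun w hw => hτ1 w hw p)]
    simp [lineDeriv]
  have hφ2 : ∀ n, ∀ z ∈ D, ∀ p q,
      lineDeriv ℝ (fun w => lineDeriv ℝ (uncurry₂ (v.φ n)) w (0, p)) z (0, q) = 0 := by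
    intro n z hz
    refine hpol (hφs n z hz) fun p => ?_
    rw [(hdet z hz p n).2.1, hTp z hz p]
    ring
  have hφt : ∀ n, ∀ z ∈ D, ∀ p,
      lineDeriv ℝ (fun w => lineDeriv ℝ (uncurry₂ (v.φ n)) w (0, p)) z (1, 0) =
      deriv (deriv θ) z.1 * (p n / 2) := by
    intro n z hz p
    have h1 := (hdet z hz p n).2.2.1
    have h2 : c.forceDeriv (v.τ z.1) z.2 = 0 := forceDeriv_eq_zero fun w => by
      rw [lineDeriv_uncurry₂]
      exact hτ1 z hz w
    rw [hT2 z hz, h2, hτ1 z hz] at h1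
    linarith
  have hL : ∀ n, ∃ L : c.Config →ₗ[ℝ] ℝ, (∀ z ∈ D, ∀ p,
      lineDeriv ℝ (uncurry₂ (v.φ n)) z (0, p) = L p + deriv θ z.1 * (p n / 2)) ∧
      ∀ {t u}, t ∈ I → c.InBox U u →
        v.φ n t u = v.φ n t u₀ + L (u - u₀) + deriv θ t * ((u - u₀) n / 2) := by
    intro n
    let ρ : ℝ × c.Config →ₗ[ℝ] ℝ :=
      (2⁻¹ : ℝ) • (Finsupp.lapply n ∘ₗ LinearMap.snd ℝ ℝ c.Config)
    have hρ : ∀ z, ρ z = z.2 n / 2 := fun z => by simp [ρ]; ring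
    -- Since `φ_{tu}` contributes `θ'' u_n / 2`, the term `θ' u_n / 2` is removed first, and the
    -- derivative of the rest in `u` is constant. Writing `θ'` as the time derivative of `τ` makes
    -- the slice smoothness of the correction immediate.
    set g : ℝ × c.Config → ℝ := fun z =>
      uncurry₂ (v.φ n) z - lineDeriv ℝ (uncurry₂ v.τ) z (1, 0) * ρ z with hg
    have hTs : ∀ z ∈ D, SliceSmoothAt (fun z => lineDeriv ℝ (uncurry₂ v.τ) z (1, 0)) z :=
      fun z hz => (hτs z hz).lineDeriv _
    have hgs : ∀ z ∈ D, SliceSmoothAt g z := fun z hz =>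
      (hφs n z hz).sub ((hTs z hz).mul (sliceSmoothAt_linear ρ z))
    have hTv : ∀ z ∈ D, ∀ w : ℝ × c.Config, lineDeriv ℝ (fun z =>
        lineDeriv ℝ (uncurry₂ v.τ) z (1, 0)) z w = w.1 * deriv (deriv θ) z.1 := by
      intro z hz w
      have e : w = w.1 • (1, 0) + (0, w.2) := by ext <;> simp
      conv_lhs => rw [e]
      rw [(hTs z hz).lineDeriv_add, lineDeriv_smul, hT2 z hz, (hτs z hz).lineDeriv_comm,
        hTp z hz, smul_eq_mul, add_zero]
    have hgp : ∀ z ∈ D, ∀ p, lineDeriv ℝ g z (0, p) = lineDeriv ℝ (uncurry₂ (v.φ n)) z (0, p) -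
        lineDeriv ℝ (uncurry₂ v.τ) z (1, 0) * (p n / 2) := by
      intro z hz p
      rw [hg, lineDeriv_sub_fun (hφs n z hz) ((hTs z hz).mul (sliceSmoothAt_linear ρ z)),
        lineDeriv_mul_fun (hTs z hz) (sliceSmoothAt_linear ρ z), lineDeriv_linear, hTv z hz, hρ,
        hρ]
      simp
    obtain ⟨L, hL1, hL2⟩ := exists_linear_of_lineDeriv_const hconv hgs ⟨_, hmem ht₀ hu₀⟩
      fun z hz p w => by
        have e : w = w.1 • (1, 0) + (0, w.2) := by ext <;> simp
        rw [lineDeriv_congr_on hopen hz (fun x hx => hgp x hx p),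
          lineDeriv_sub_fun ((hφs n z hz).lineDeriv _) ((hTs z hz).mul (sliceSmoothAt_const _ z)),
          lineDeriv_mul_fun (hTs z hz) (sliceSmoothAt_const _ z), hTv z hz]
        conv_lhs => enter [1]; rw [e]
        rw [((hφs n z hz).lineDeriv _).lineDeriv_add, lineDeriv_smul, hφt n z hz, hφ2 n z hz]
        simp [lineDeriv]
        ring
    refine ⟨L, fun z hz p => ?_, fun {t u} ht hu => ?_⟩
    · have := hL1 z hz p
      rw [hgp z hz p, hT1 z hz] at this
      linarith
    · have := hL2 t u u₀ (hmem ht hu) (hmem ht hu₀)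
      simp only [hg, hρ] at this
      simp only [uncurry₂] at this
      have e1 := hT1 _ (hmem ht hu)
      have e2 := hT1 _ (hmem ht hu₀)
      simp only at e1 e2
      rw [e1, e2] at this
      rw [Finsupp.sub_apply]
      linarith
  choose L hL1 hL2 using hL
  set K : c.sites → ℝ → ℝ := fun n t =>
    lineDeriv ℝ (fun w => lineDeriv ℝ (uncurry₂ (v.φ n)) w (1, 0)) (t, u₀) (1, 0) with hK
  have hKu : ∀ n {t u}, t ∈ I → c.InBox U u →
      lineDeriv ℝ (fun w => lineDeriv ℝ (uncurry₂ (v.φ n)) w (1, 0)) (t, u) (1, 0) =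
        K n t + deriv (deriv (deriv θ)) t * ((u - u₀) n / 2) := by
    intro n t u ht hu
    have h1 : ∀ t, (t, u) ∈ D → (t, u₀) ∈ D → lineDeriv ℝ (uncurry₂ (v.φ n)) (t, u) (1, 0) =
        lineDeriv ℝ (uncurry₂ (v.φ n)) (t, u₀) (1, 0) +
          deriv (deriv θ) t * ((u - u₀) n / 2) := by
      intro t h h₀
      have hd := ((hθ1 t h.1).contDiffAt.differentiableAt (by simp))
      rw [lineDeriv_fst_add (θ := fun t => L n (u - u₀) + deriv θ t * ((u - u₀) n / 2)) hopen
        (fun s hs _ => by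
          have := hL2 n hs.1 hs.2
          rw [add_assoc] at this
          exact this) h h₀ (hφs n _ h₀) ((hd.mul_const _).const_add _), deriv_const_add,
        deriv_mul_const hd]
    have hd := ((hθ2 t ht).contDiffAt.differentiableAt (by simp))
    rw [lineDeriv_fst_add (θ := fun t => deriv (deriv θ) t * ((u - u₀) n / 2)) hopen h1
      (hmem ht hu) (hmem ht hu₀) ((hφs n _ (hmem ht hu₀)).lineDeriv _) (hd.mul_const _),
      deriv_mul_const hd]
  let M : c.sites → ℝ → c.Config →ₗ[ℝ] ℝ := fun n t => L n + (deriv θ t / 2) • Finsupp.lapply n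
  have hM : ∀ n t u, M n t u = L n u + deriv θ t * (u n / 2) := fun n t u => by
    simp [M]; ring
  have hforce : ∀ n {t u}, t ∈ I → c.InBox U u → ∀ m,
      c.forceTerm (v.φ n t) u m = -(c.expo m u * M n t (c.rootOn m)) := by
    intro n t u ht hu m
    rw [forceTerm_eq, lineDeriv_uncurry₂, hL1 n _ (hmem ht hu), hM, map_neg, Finsupp.neg_apply]
    ring
  set f : c.sites → ℝ → ℝ := fun n t => v.φ n t u₀ - M n t u₀ with hf
  have hφ : ∀ n {t u}, t ∈ I → c.InBox U u → v.φ n t u = M n t u + f n t := by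
    intro n t u ht hu
    simp only [hf]
    rw [hL2 n ht hu, hM, hM, map_sub, Finsupp.sub_apply]
    ring
  -- For each fixed `t`. The second time derivative of `θ' u_n / 2` produces the linear term `Λ`,
  -- and `κ` is normalized so that `Λ + κ` equals `K` at `u₀`.
  have hsolve : ∀ {t}, t ∈ I → _ := fun {t} ht =>
    hc.solve (L := fun n => M n t)
      (Λ := fun n => (deriv (deriv (deriv θ)) t / 2) • Finsupp.lapply n) (f := fun n => f n t)
      (κ := fun n => K n t - deriv (deriv (deriv θ)) t * (u₀ n / 2))
      (σ := 2 * deriv θ t) hUo ⟨u₀, hu₀⟩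
      (fun u hu n => by
        have := (hv.summable_φ n t ht u hu).neg
        simpa [hforce n ht hu] using this)
      (fun u hu n => by
        have h1 := (hdet _ (hmem ht hu) 0 n).2.2.2
        rw [hKu n ht hu, Chain.forceDeriv, tsum_congr (hforce n ht hu), tsum_neg,
          force_eq, LatticeVF.derivForce_eq, hT1 _ (hmem ht hu)] at h1
        simp only [hφ _ ht hu] at h1
        have h2 : ∑ m ∈ near n, c.rootOn m n * c.expo m u * (2 * deriv θ t +
            pair (c.rootOn m) fun l => M l t u + f l t) = 2 * deriv θ t *
            ∑ m ∈ near n, c.rootOn m n * c.expo m u + ∑ m ∈ near n, c.rootOn m n *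
            c.expo m u * pair (c.rootOn m) fun l => M l t u + f l t := by
          rw [Finset.mul_sum, ← Finset.sum_add_distrib]
          exact Finset.sum_congr rfl fun _ _ => by ring
        rw [h2]
        simp only [LinearMap.smul_apply, Finsupp.lapply_apply, smul_eq_mul]
        rw [Finsupp.sub_apply] at h1
        linarith)
  set o : c.sites := ⟨1, hc.one_mem⟩ with ho
  -- By `solve` both `L_2` and `L_1 + (θ' / 2) u_1` take the value `b(t)` on the unit vector at site
  -- `1`. The first is independent of `t`, so `b` is constant, and then so is `θ'`.
  have hMt : ∀ {t}, t ∈ I → ∀ n u, M n t u = M n t₀ u ∧ deriv θ t = deriv θ t₀ := by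
    intro t ht
    obtain ⟨⟨b, -, hb⟩, -⟩ := hsolve ht
    obtain ⟨⟨b₀, -, hb₀⟩, -⟩ := hsolve ht₀
    have e1 : ∀ n, M n t (Finsupp.single o 1) = b := fun n => by rw [hb]; simp
    have e2 : ∀ n, M n t₀ (Finsupp.single o 1) = b₀ := fun n => by rw [hb₀]; simp
    have h12 : (⟨2, hc.two_mem⟩ : c.sites) ≠ o := fun h => by
      simpa [ho] using congrArg Subtype.val h
    have q1 := e1 ⟨2, hc.two_mem⟩
    have q2 := e2 ⟨2, hc.two_mem⟩
    have q3 := e1 o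
    have q4 := e2 o
    rw [hM, Finsupp.single_eq_of_ne h12] at q1 q2
    rw [hM, Finsupp.single_eq_same] at q3 q4
    have hbb : b = b₀ := by linarith
    exact fun n u => ⟨by rw [hb, hb₀, hbb], by linarith⟩
  set d := deriv θ t₀ with hd
  have hθd : ∀ t ∈ I, deriv θ t = d := fun t ht => (hMt ht o 0).2
  have hθaff : ∀ {t}, t ∈ I → θ t = θ t₀ + d * (t - t₀) := fun ht =>
    affine_of_deriv_eq hI.convex hθ0 hθd ht₀ ht
  obtain ⟨⟨b, hbT, hb⟩, -⟩ := hsolve ht₀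
  have hKz : ∀ {t}, t ∈ I → ∀ n, K n t = 0 := fun {t} ht n => by
    have := (hsolve ht).2.1 u₀ hu₀ n
    simp only [LinearMap.smul_apply, Finsupp.lapply_apply, smul_eq_mul] at this
    linarith
  have hfn : ∀ n {t}, t ∈ I → f n t = f o t + 2 * d * (((n : ℤ) : ℝ) - 1) := fun n t ht => by
    have := (hsolve ht).2.2.1 n
    rwa [hθd t ht] at this
  -- dependence on time
  have hψs : ∀ t ∈ I, SliceSmoothAt (fun t => v.φ o t u₀) t := hθs (hφs o)
  have hψ1 : ∀ t ∈ I, deriv (fun t => v.φ o t u₀) t =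
      lineDeriv ℝ (uncurry₂ (v.φ o)) (t, u₀) (1, 0) := by
    intro t _
    rw [← lineDeriv_one]
    simp [lineDeriv, uncurry₂]
  have hψ2 : ∀ t ∈ I, deriv (deriv fun t => v.φ o t u₀) t = 0 := by
    intro t ht
    rw [← hKz ht o, hK, ← lineDeriv_one]
    refine Filter.EventuallyEq.deriv_eq ?_
    filter_upwards [hopen.eventually_line (hmem ht hu₀) (1, 0)] with s hs
    simp only [Prod.smul_mk, smul_zero, Prod.mk_add_mk, add_zero] at hs ⊢
    exact hψ1 _ hs.1
  set B := deriv (fun t => v.φ o t u₀) t₀ with hB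
  have hψ3 : ∀ t ∈ I, deriv (fun t => v.φ o t u₀) t = B := by
    intro t ht
    have := affine_of_deriv_eq hI.convex (hderiv hψs) hψ2 ht₀ ht
    rw [this, hB]
    ring
  have hfo : ∀ {t}, t ∈ I → f o t = f o t₀ + B * (t - t₀) := by
    intro t ht
    have := affine_of_deriv_eq hI.convex hψs hψ3 ht₀ ht
    simp only [hf]
    rw [this, (hMt ht o u₀).1]
    ring
  -- In the series `B`, `C`, `D` the left end fixes `f` at site `1` in terms of the constant `d`,
  -- which excludes linear growth in time.
  have hB0 : (∀ t ∈ I, f o t = f o t₀) → B = 0 := by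
    intro h
    obtain ⟨s, hs, hs0⟩ := (((hI.1.eventually_mem ht₀).filter_mono nhdsWithin_le_nhds).and
      (self_mem_nhdsWithin (s := {t₀}ᶜ))).exists
    have := hfo hs
    rw [h s hs] at this
    have h2 : B * (s - t₀) = 0 := by linarith
    exact (mul_eq_zero.1 h2).resolve_right (sub_ne_zero.2 hs0)
  -- The expansions about `t₀` are rewritten about `0`, and `-2 * d` accounts for the passage from
  -- `n - 1` to `n`.
  refine ⟨⟨θ t₀ - d * t₀, d, f o t₀ - B * t₀ - 2 * d, B, b⟩, ?_, fun t ht u hu =>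
    ⟨?_, fun n => ?_⟩⟩
  · have hend : ∀ t ∈ I, endValue (2 * d) (f o t) T := fun t ht => by
      have := (hsolve ht).2.2.2
      rwa [hθd t ht] at this
    cases T with
    | A => trivial
    | B =>
      have h : ∀ t ∈ I, f o t = 2 * d := hend
      have hB' := hB0 fun t ht => by rw [h t ht, h t₀ ht₀]
      refine ⟨?_, hB', hbT (by simp)⟩
      simp only
      rw [h t₀ ht₀, hB']
      ring
    | C =>
      have h : ∀ t ∈ I, 2 * f o t = 2 * d := hend
      have hB' := hB0 fun t ht => by linarith [h t ht, h t₀ ht₀]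
      refine ⟨?_, hB', hbT (by simp)⟩
      simp only
      rw [hB']
      linarith [h t₀ ht₀]
    | D =>
      have h : ∀ t ∈ I, f o t = 0 := hend
      have hB' := hB0 fun t ht => by rw [h t ht, h t₀ ht₀]
      refine ⟨?_, hB', hbT (by simp)⟩
      simp only
      rw [h t₀ ht₀, hB']
      ring
  · rw [hτ ht hu, hθaff ht]
    simp only [LatticeParams.on]
    ring
  · rw [hφ n ht hu, (hMt ht n u).1, hb, hfn n ht, hfo ht]
    simp only [LatticeParams.on]
    ring

end LatticeForward

/-! ### Invariance under equality on the box -/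

section Congr

variable {c : Chain} {I J : Set ℝ} {U : ℤ → Set ℝ}

lemma FieldVF.EqOn.symm {v w : FieldVF c} (h : v.EqOn I J U w) : w.EqOn I J U v :=
  fun x hx y hy u hu => ⟨(h x hx y hy u hu).1.symm, (h x hx y hy u hu).2.1.symm,
    fun n => ((h x hx y hy u hu).2.2 n).symm⟩

lemma FieldVF.EqOn.trans {v w z : FieldVF c} (h : v.EqOn I J U w) (h' : w.EqOn I J U z) :
    v.EqOn I J U z :=
  fun x hx y hy u hu => ⟨(h x hx y hy u hu).1.trans (h' x hx y hy u hu).1,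
    (h x hx y hy u hu).2.1.trans (h' x hx y hy u hu).2.1,
    fun n => ((h x hx y hy u hu).2.2 n).trans ((h' x hx y hy u hu).2.2 n)⟩

lemma LatticeVF.EqOn.symm {v w : LatticeVF c} (h : v.EqOn I U w) : w.EqOn I U v :=
  fun t ht u hu => ⟨(h t ht u hu).1.symm, fun n => ((h t ht u hu).2 n).symm⟩

lemma LatticeVF.EqOn.trans {v w z : LatticeVF c} (h : v.EqOn I U w) (h' : w.EqOn I U z) :
    v.EqOn I U z :=
  fun t ht u hu => ⟨(h t ht u hu).1.trans (h' t ht u hu).1,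
    fun n => ((h t ht u hu).2 n).trans ((h' t ht u hu).2 n)⟩

lemma extend_apply_of_mem {c c' : Chain} (h : c.sites ⊆ c'.sites) (u : c.Config) (n : c.sites) :
    extend h u (Set.inclusion h n) = u n :=
  Finsupp.mapDomain_apply (Set.inclusion_injective h) u n

lemma Chain.InBox.extend {c c' : Chain} (h : c.sites ⊆ c'.sites) {u : c.Config}
    (hu : c.InBox U u) (hU0 : ∀ n ∉ c.sites, (0 : ℝ) ∈ U n) : c'.InBox U (extend h u) := by
  intro n
  by_cases hn : (n : ℤ) ∈ c.sites
  · have := extend_apply_of_mem h u ⟨n, hn⟩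
    have e : Set.inclusion h ⟨n, hn⟩ = n := Subtype.ext rfl
    rw [e] at this
    rw [this]
    exact hu ⟨n, hn⟩
  · have : Toda.extend h u n = 0 := Finsupp.mapDomain_of_notMem_range u n fun ⟨k, hk⟩ =>
      hn (by rw [← hk]; exact k.2)
    rw [this]
    exact hU0 n hn

lemma FieldVF.EqOn.reduce {c c' : Chain} (h : c.sites ⊆ c'.sites)
    (hU0 : ∀ n ∉ c.sites, (0 : ℝ) ∈ U n) {v w : FieldVF c'} (hvw : v.EqOn I J U w) :
    (v.reduce h).EqOn I J U (w.reduce h) := fun x hx y hy _ hu =>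
  have H := hvw x hx y hy _ (hu.extend h hU0)
  ⟨H.1, H.2.1, fun n => H.2.2 (Set.inclusion h n)⟩

lemma LatticeVF.EqOn.reduce {c c' : Chain} (h : c.sites ⊆ c'.sites)
    (hU0 : ∀ n ∉ c.sites, (0 : ℝ) ∈ U n) {v w : LatticeVF c'} (hvw : v.EqOn I U w) :
    (v.reduce h).EqOn I U (w.reduce h) := fun t ht _ hu =>
  have H := hvw t ht _ (hu.extend h hU0)
  ⟨H.1, fun n => H.2 (Set.inclusion h n)⟩

lemma sum_extend {c c' : Chain} (h : c.sites ⊆ c'.sites) (u : c.Config) :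
    ((extend h u).sum fun _ a => a) = u.sum fun _ a => a :=
  Finsupp.sum_mapDomain_index (by simp) (by simp)

lemma FieldParams.on_reduce (P : FieldParams) {c c' : Chain} (h : c.sites ⊆ c'.sites) :
    (P.on c').reduce h = P.on c := by
  simp only [FieldVF.reduce, FieldParams.on, sum_extend]

lemma LatticeParams.on_reduce (P : LatticeParams) {c c' : Chain} (h : c.sites ⊆ c'.sites) :
    (P.on c').reduce h = P.on c := by
  simp only [LatticeVF.reduce, LatticeParams.on, sum_extend]

/-- The box is open along slices, so every derivative in the prolongation sees only values on the
box, while the derivative of `F_n` along the field uses only values at the point itself. -/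
theorem FieldVF.IsSymmetry.congr (hI : IsOpen I) (hJ : IsOpen J) (hU : ∀ n, IsOpen (U n))
    {v w : FieldVF c} (hw : w.IsSymmetry I J U) (hvw : v.EqOn I J U w) :
    v.IsSymmetry I J U := by
  have hopen : SliceOpen (boxDomain c (I ×ˢ J) U) := sliceOpen_boxDomain (hI.prod hJ) hU
  have hξ : Set.EqOn (uncurry₃ v.ξ) (uncurry₃ w.ξ) (boxDomain c (I ×ˢ J) U) :=
    fun z hz => (hvw _ hz.1.1 _ hz.1.2 _ hz.2).1
  have hη : Set.EqOn (uncurry₃ v.η) (uncurry₃ w.η) (boxDomain c (I ×ˢ J) U) :=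
    fun z hz => (hvw _ hz.1.1 _ hz.1.2 _ hz.2).2.1
  have hφ : ∀ n, Set.EqOn (uncurry₃ (v.φ n)) (uncurry₃ (w.φ n)) (boxDomain c (I ×ˢ J) U) :=
    fun n z hz => (hvw _ hz.1.1 _ hz.1.2 _ hz.2).2.2 n
  have hterm : ∀ {g h : ℝ → ℝ → c.Config → ℝ},
      Set.EqOn (uncurry₃ g) (uncurry₃ h) (boxDomain c (I ×ˢ J) U) → ∀ x ∈ I, ∀ y ∈ J, ∀ u,
      c.InBox U u → c.forceTerm (g x y) u = c.forceTerm (h x y) u := by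
    intro g h hgh x hx y hy u hu
    ext m
    rw [forceTerm_eq, forceTerm_eq, lineDeriv_uncurry₃, lineDeriv_uncurry₃,
      lineDeriv_congr_on hopen (z := ((x, y), u)) ⟨⟨hx, hy⟩, hu⟩ hgh]
  have hXY : ∀ {g h : ℝ → ℝ → c.Config → ℝ},
      Set.EqOn (uncurry₃ g) (uncurry₃ h) (boxDomain c (I ×ˢ J) U) → ∀ x ∈ I, ∀ y ∈ J, ∀ u,
      c.InBox U u → ∀ p q, totalXY g x y u p q = totalXY h x y u p q := by
    intro g h hgh x hx y hy u hu p q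
    rw [totalXY_eq, totalXY_eq, Chain.forceDeriv, Chain.forceDeriv, hterm hgh x hx y hy u hu,
      lineDeriv_congr_on hopen (z := ((x, y), u)) ⟨⟨hx, hy⟩, hu⟩
        fun z hz => lineDeriv_congr_on hopen hz hgh _]
  have hX : ∀ {g h : ℝ → ℝ → c.Config → ℝ},
      Set.EqOn (uncurry₃ g) (uncurry₃ h) (boxDomain c (I ×ˢ J) U) → ∀ x ∈ I, ∀ y ∈ J, ∀ u,
      c.InBox U u → ∀ p, totalX g x y u p = totalX h x y u p ∧
        totalY g x y u p = totalY h x y u p := by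
    intro g h hgh x hx y hy u hu p
    rw [totalX_eq, totalX_eq, totalY_eq, totalY_eq,
      lineDeriv_congr_on hopen (z := ((x, y), u)) ⟨⟨hx, hy⟩, hu⟩ hgh,
      lineDeriv_congr_on hopen (z := ((x, y), u)) ⟨⟨hx, hy⟩, hu⟩ hgh]
    exact ⟨rfl, rfl⟩
  refine ⟨fun S => (hw.smooth_ξ S).congr fun z hz => (hvw _ hz.1 _ hz.2.1 _ hz.2.2).1,
    fun S => (hw.smooth_η S).congr fun z hz => (hvw _ hz.1 _ hz.2.1 _ hz.2.2).2.1,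
    fun n S => (hw.smooth_φ n S).congr fun z hz => (hvw _ hz.1 _ hz.2.1 _ hz.2.2).2.2 n,
    fun x hx y hy u hu => ?_, fun x hx y hy u hu => ?_, fun n x hx y hy u hu => ?_,
    fun x hx y hy u hu p q r s n => ?_⟩
  · rw [hterm hξ x hx y hy u hu]
    exact hw.summable_ξ x hx y hy u hu
  · rw [hterm hη x hx y hy u hu]
    exact hw.summable_η x hx y hy u hu
  · rw [hterm (hφ n) x hx y hy u hu]
    exact hw.summable_φ n x hx y hy u hu
  · have h := hw.annihilates x hx y hy u hu p q r s n
    rw [FieldVF.derivForce_eq] at h ⊢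
    rw [FieldVF.prolongXY] at h ⊢
    rw [hXY (hφ n) x hx y hy u hu, hXY hξ x hx y hy u hu, hXY hη x hx y hy u hu,
      (hX hξ x hx y hy u hu p).1, (hX hξ x hx y hy u hu q).2, (hX hη x hx y hy u hu p).1,
      (hX hη x hx y hy u hu q).2, h]
    simp only [(hvw x hx y hy u hu).2.2]

theorem LatticeVF.IsSymmetry.congr (hI : IsOpen I) (hU : ∀ n, IsOpen (U n))
    {v w : LatticeVF c} (hw : w.IsSymmetry I U) (hvw : v.EqOn I U w) : v.IsSymmetry I U := by
  have hopen : SliceOpen (boxDomain c I U) := sliceOpen_boxDomain hI hU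
  have hτ : Set.EqOn (uncurry₂ v.τ) (uncurry₂ w.τ) (boxDomain c I U) :=
    fun z hz => (hvw _ hz.1 _ hz.2).1
  have hφ : ∀ n, Set.EqOn (uncurry₂ (v.φ n)) (uncurry₂ (w.φ n)) (boxDomain c I U) :=
    fun n z hz => (hvw _ hz.1 _ hz.2).2 n
  have hterm : ∀ {g h : ℝ → c.Config → ℝ},
      Set.EqOn (uncurry₂ g) (uncurry₂ h) (boxDomain c I U) → ∀ t ∈ I, ∀ u,
      c.InBox U u → c.forceTerm (g t) u = c.forceTerm (h t) u := by
    intro g h hgh t ht u hu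
    ext m
    rw [forceTerm_eq, forceTerm_eq, lineDeriv_uncurry₂, lineDeriv_uncurry₂,
      lineDeriv_congr_on hopen (z := (t, u)) ⟨ht, hu⟩ hgh]
  have hTT : ∀ {g h : ℝ → c.Config → ℝ},
      Set.EqOn (uncurry₂ g) (uncurry₂ h) (boxDomain c I U) → ∀ t ∈ I, ∀ u,
      c.InBox U u → ∀ p, totalTT g t u p = totalTT h t u p ∧ totalT g t u p = totalT h t u p := by
    intro g h hgh t ht u hu p
    rw [totalTT_eq, totalTT_eq, Chain.forceDeriv, Chain.forceDeriv, hterm hgh t ht u hu,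
      lineDeriv_congr_on hopen (z := (t, u)) ⟨ht, hu⟩
        fun z hz => lineDeriv_congr_on hopen hz hgh _, totalT_eq, totalT_eq,
      lineDeriv_congr_on hopen (z := (t, u)) ⟨ht, hu⟩ hgh]
    exact ⟨rfl, rfl⟩
  refine ⟨fun S => (hw.smooth_τ S).congr fun z hz => (hvw _ hz.1 _ hz.2).1,
    fun n S => (hw.smooth_φ n S).congr fun z hz => (hvw _ hz.1 _ hz.2).2 n,
    fun t ht u hu => ?_, fun n t ht u hu => ?_, fun t ht u hu p n => ?_⟩
  · rw [hterm hτ t ht u hu]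
    exact hw.summable_τ t ht u hu
  · rw [hterm (hφ n) t ht u hu]
    exact hw.summable_φ n t ht u hu
  · have h := hw.annihilates t ht u hu p n
    rw [LatticeVF.derivForce_eq] at h ⊢
    rw [LatticeVF.prolongTT] at h ⊢
    rw [(hTT (hφ n) t ht u hu p).1, (hTT hτ t ht u hu p).1, (hTT hτ t ht u hu p).2, h]
    simp only [(hvw t ht u hu).2]

end Congr

/-! ### The generators are symmetries -/

section Generators

variable {c : Chain}

/-- The sum of the fields as a linear functional. -/
noncomputable def totalSum (c : Chain) : c.Config →ₗ[ℝ] ℝ :=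
  Finsupp.lsum ℝ fun _ => LinearMap.id

lemma totalSum_apply (u : c.Config) : totalSum c u = u.sum fun _ a => a := rfl

lemma totalSum_eq_pair (u : c.Config) : totalSum c u = pair u fun _ => 1 := by
  simp [totalSum_apply, pair]

lemma totalSum_ofCoords (S : Finset c.sites) (a : S → ℝ) :
    totalSum c (c.ofCoords S a) = ∑ n : S, a n := by
  have h : ∀ (n : c.sites) (x : ℝ), totalSum c (Finsupp.single n x) = x := fun n x => by
    simp [totalSum_apply]
  simp only [Chain.ofCoords, map_sum, h]

lemma contDiff_totalSum_ofCoords (S : Finset c.sites) :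
    ContDiff ℝ ∞ fun a : S → ℝ => (c.ofCoords S a).sum fun _ a => a := by
  simp only [← totalSum_apply, totalSum_ofCoords]
  fun_prop

lemma pair_affine (a : c.Config) (σ k : ℝ) :
    (pair a fun l => σ * ((l : ℤ) : ℝ) + k) =
      σ * (pair a fun l => ((l : ℤ) : ℝ)) + k * totalSum c a := by
  rw [pair_add_right, pair_smul_right, totalSum_eq_pair, ← pair_smul_right a k]
  simp only [mul_one]

/-- The condition `hroot` says that every nonzero root satisfies `α_m · φ = -(ξ' + η')` and that `c
∑ u_m` is constant along it. The field then scales all exponentials alike, which exactly balances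
the change of `∂_x ∂_y`, and the series in the prolongation vanish term by term. -/
theorem FieldParams.on_isSymmetry {P : FieldParams} {I J : Set ℝ} (hI : IsOpen I) (hJ : IsOpen J)
    (U : ℤ → Set ℝ) (hP : P.Smooth I J)
    (hroot : ∀ m, c.rootOn m = 0 ∨ (P.c * totalSum c (c.rootOn m) = 0 ∧ ∀ x ∈ I, ∀ y ∈ J,
      (deriv P.ξ x + deriv P.η y) * (pair (c.rootOn m) fun l => ((l : ℤ) : ℝ)) +
        (P.β x + P.γ y) * totalSum c (c.rootOn m) = -(deriv P.ξ x + deriv P.η y))) :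
    (P.on c).IsSymmetry I J U := by
  obtain ⟨hξ, hη, hβ, hγ⟩ := hP
  have hx : ∀ {g : ℝ → ℝ} (S : Finset c.sites), ContDiffOn ℝ ∞ g I →
      ContDiffOn ℝ ∞ (fun z : ℝ × ℝ × (S → ℝ) => g z.1)
        {z | z.1 ∈ I ∧ z.2.1 ∈ J ∧ c.InBox U (c.ofCoords S z.2.2)} := fun S hg =>
    hg.comp contDiff_fst.contDiffOn fun z hz => hz.1
  have hy : ∀ {g : ℝ → ℝ} (S : Finset c.sites), ContDiffOn ℝ ∞ g J →
      ContDiffOn ℝ ∞ (fun z : ℝ × ℝ × (S → ℝ) => g z.2.1)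
        {z | z.1 ∈ I ∧ z.2.1 ∈ J ∧ c.InBox U (c.ofCoords S z.2.2)} := fun S hg =>
    hg.comp (contDiff_fst.comp contDiff_snd).contDiffOn fun z hz => hz.2.1
  have hc0 : ∀ m, P.c * totalSum c (c.rootOn m) = 0 := fun m => by
    rcases hroot m with h | h
    · simp [h]
    · exact h.1
  have hterm : ∀ n x y u m, c.forceTerm ((P.on c).φ n x y) u m = 0 := by
    intro n x y u m
    have : lineDeriv ℝ ((P.on c).φ n x y) u (-c.rootOn m) = 0 := by
      simp only [lineDeriv, FieldParams.on, ← totalSum_apply, deriv_const_add]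
      simp only [map_add, map_smul, map_neg, smul_eq_mul, mul_add, mul_neg]
      have : ∀ t : ℝ, P.c * (t * totalSum c (c.rootOn m)) = 0 := fun t => by
        rw [mul_left_comm, hc0, mul_zero]
      simp [this]
    rw [forceTerm_eq, this, mul_zero]
  have hξterm : ∀ x y u m, c.forceTerm ((P.on c).ξ x y) u m = 0 := by
    simp [Chain.forceTerm, FieldParams.on]
  have hηterm : ∀ x y u m, c.forceTerm ((P.on c).η x y) u m = 0 := by
    simp [Chain.forceTerm, FieldParams.on]
  refine ⟨fun S => hx S hξ, fun S => hy S hη, fun n S => ?_, fun x _ y _ u _ => ?_,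
    fun x _ y _ u _ => ?_, fun n x _ y _ u _ => ?_, fun x hxI y hyJ u _ p q r s n => ?_⟩
  · have h1 := ((hx S (hξ.deriv_of_isOpen (m := ∞) hI (by simp))).add
      (hy S (hη.deriv_of_isOpen (m := ∞) hJ (by simp)))).mul
      (contDiffOn_const (c := ((n : ℤ) : ℝ)))
    have h2 : ContDiff ℝ ∞ fun z : ℝ × ℝ × (S → ℝ) =>
        P.c * (c.ofCoords S z.2.2).sum fun _ a => a :=
      contDiff_const.mul ((contDiff_totalSum_ofCoords S).comp (contDiff_snd.comp contDiff_snd))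
    exact (h1.add ((hx S hβ).add (hy S hγ))).add h2.contDiffOn
  · simp only [funext (hξterm x y u)]
    exact summable_zero
  · simp only [funext (hηterm x y u)]
    exact summable_zero
  · simp only [funext (hterm n x y u)]
    exact summable_zero
  · have e1 : totalXY ((P.on c).φ n) x y u p q = 0 := by
      have : ∀ s : ℝ, deriv (fun t : ℝ => (P.on c).φ n (x + s) (y + t) (u + s • p + t • q)) 0 =
          deriv (fun t : ℝ => deriv P.η (y + t) * ((n : ℤ) : ℝ) + P.γ (y + t) +
            P.c * totalSum c (t • q)) 0 := by
        intro s
        rw [← deriv_const_add (f := fun t : ℝ => deriv P.η (y + t) * ((n : ℤ) : ℝ) + P.γ (y + t) +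
            P.c * totalSum c (t • q)) (deriv P.ξ (x + s) * ((n : ℤ) : ℝ) + P.β (x + s) +
            P.c * totalSum c (u + s • p))]
        congr 1
        ext t
        simp only [FieldParams.on, ← totalSum_apply, map_add]
        ring
      simp [totalXY, this, Chain.forceDeriv, hterm]
    have e2 : totalXY (P.on c).ξ x y u p q = 0 := by
      simp only [totalXY, Chain.forceDeriv, hξterm]
      simp [FieldParams.on]
    have e3 : totalXY (P.on c).η x y u p q = 0 := by
      simp only [totalXY, Chain.forceDeriv, hηterm]
      simp [FieldParams.on]
    have e4 : totalX (P.on c).ξ x y u p = deriv P.ξ x := by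
      simp only [totalX, FieldParams.on]
      rw [deriv_comp_const_add, add_zero]
    have e5 : totalY (P.on c).η x y u q = deriv P.η y := by
      simp only [totalY, FieldParams.on]
      rw [deriv_comp_const_add, add_zero]
    have e6 : totalY (P.on c).ξ x y u q = 0 := by simp [totalY, FieldParams.on]
    have e7 : totalX (P.on c).η x y u p = 0 := by simp [totalX, FieldParams.on]
    rw [FieldVF.prolongXY, e1, e2, e3, e4, e5, e6, e7, FieldVF.derivForce_eq, force_eq]
    -- The part of `φ` that is common to all sites pairs with `α_m` through the sum of its entries
    -- only, so the term with `P.c` drops out by `hc0`.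
    have e8 : ∀ m, c.rootOn m n * c.expo m u * (pair (c.rootOn m) fun l => (P.on c).φ l x y u) =
        -(deriv P.ξ x + deriv P.η y) * (c.rootOn m n * c.expo m u) := by
      intro m
      rcases hroot m with h | ⟨-, h⟩
      · simp [h]
      · have : (fun l => (P.on c).φ l x y u) = fun l : c.sites =>
            (deriv P.ξ x + deriv P.η y) * ((l : ℤ) : ℝ) +
              (P.β x + P.γ y + P.c * totalSum c u) := by
          ext l
          simp only [FieldParams.on, totalSum_apply]
          ring
        have h0 := hc0 m
        rw [this, pair_affine, ← h x hxI y hyJ]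
        linear_combination c.rootOn m n * c.expo m u * totalSum c u * h0
    simp only [e8, ← Finset.mul_sum]
    ring

theorem LatticeParams.on_isSymmetry {P : LatticeParams} (I : Set ℝ) (U : ℤ → Set ℝ)
    (hroot : ∀ m, c.rootOn m = 0 ∨ (P.c * totalSum c (c.rootOn m) = 0 ∧
      P.b * totalSum c (c.rootOn m) = 0 ∧
      2 * P.d * (pair (c.rootOn m) fun l => ((l : ℤ) : ℝ)) +
        P.a * totalSum c (c.rootOn m) = -(2 * P.d))) :
    (P.on c).IsSymmetry I U := by
  have hc0 : ∀ m, P.c * totalSum c (c.rootOn m) = 0 := fun m => by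
    rcases hroot m with h | h
    · simp [h]
    · exact h.1
  have hterm : ∀ n t u m, c.forceTerm ((P.on c).φ n t) u m = 0 := by
    intro n t u m
    have : lineDeriv ℝ ((P.on c).φ n t) u (-c.rootOn m) = 0 := by
      simp only [lineDeriv, LatticeParams.on, ← totalSum_apply, deriv_const_add]
      simp only [map_add, map_smul, map_neg, smul_eq_mul, mul_add, mul_neg]
      have : ∀ t : ℝ, P.c * (t * totalSum c (c.rootOn m)) = 0 := fun t => by
        rw [mul_left_comm, hc0, mul_zero]
      simp [this]
    rw [forceTerm_eq, this, mul_zero]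
  have hτterm : ∀ t u m, c.forceTerm ((P.on c).τ t) u m = 0 := by
    simp [Chain.forceTerm, LatticeParams.on]
  have hlin : ∀ A B : ℝ, deriv (fun s : ℝ => A + B * s) = fun _ => B := fun A B => by
    ext s
    simp [deriv_const_add]
  have hlin2 : ∀ A B : ℝ, iteratedDeriv 2 (fun s : ℝ => A + B * s) 0 = 0 := fun A B => by
    rw [iteratedDeriv_succ, iteratedDeriv_one, hlin]
    simp
  refine ⟨fun S => ?_, fun n S => ?_, fun t _ u _ => ?_, fun n t _ u _ => ?_,
    fun t _ u _ p n => ?_⟩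
  · have : ContDiff ℝ ∞ fun z : ℝ × (S → ℝ) => P.p + P.d * z.1 := by fun_prop
    exact this.contDiffOn
  · have h1 : ContDiff ℝ ∞ fun z : ℝ × (S → ℝ) =>
      2 * P.d * ((n : ℤ) : ℝ) + P.a + P.b * z.1 := by fun_prop
    exact (h1.add (contDiff_const.mul
      ((contDiff_totalSum_ofCoords S).comp contDiff_snd))).contDiffOn
  · simp only [funext (hτterm t u)]
    exact summable_zero
  · simp only [funext (hterm n t u)]
    exact summable_zero
  · have e1 : totalTT ((P.on c).φ n) t u p = 0 := by
      have : (fun s : ℝ => (P.on c).φ n (t + s) (u + s • p)) = fun s =>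
          (2 * P.d * ((n : ℤ) : ℝ) + P.a + P.b * t + P.c * totalSum c u) +
            (P.b + P.c * totalSum c p) * s := by
        ext s
        simp only [LatticeParams.on, ← totalSum_apply, map_add, map_smul, smul_eq_mul]
        ring
      simp [totalTT, this, hlin2, Chain.forceDeriv, hterm]
    have e0 : (fun s : ℝ => (P.on c).τ (t + s) (u + s • p)) = fun s =>
        (P.p + P.d * t) + P.d * s := by
      ext s
      simp only [LatticeParams.on]
      ring
    have e2 : totalTT (P.on c).τ t u p = 0 := by
      simp [totalTT, e0, hlin2, Chain.forceDeriv, hτterm]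
    have e3 : totalT (P.on c).τ t u p = P.d := by
      rw [totalT, e0, hlin]
    rw [LatticeVF.prolongTT, e1, e2, e3, LatticeVF.derivForce_eq, force_eq]
    have e8 : ∀ m, c.rootOn m n * c.expo m u * (pair (c.rootOn m) fun l => (P.on c).φ l t u) =
        -(2 * P.d) * (c.rootOn m n * c.expo m u) := by
      intro m
      rcases hroot m with h | ⟨-, hb, h⟩
      · simp [h]
      · have : (fun l => (P.on c).φ l t u) = fun l : c.sites =>
            2 * P.d * ((l : ℤ) : ℝ) + (P.a + P.b * t + P.c * totalSum c u) := by
          ext l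
          simp only [LatticeParams.on, totalSum_apply]
          ring
        have h0 := hc0 m
        rw [this, pair_affine, ← h]
        linear_combination c.rootOn m n * c.expo m u * totalSum c u * h0 +
          c.rootOn m n * c.expo m u * t * hb
    simp only [e8, ← Finset.mul_sum]
    ring

lemma rootOn_infinite (m : ℤ) : Chain.infinite.rootOn m =
    Finsupp.single ⟨m, trivial⟩ 1 - Finsupp.single ⟨m + 1, trivial⟩ 1 := by
  classical
  ext n
  rw [rootOn_apply, Finsupp.sub_apply, Finsupp.single_apply, Finsupp.single_apply]
  simp [Chain.root, bond_apply, Subtype.ext_iff]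

lemma pair_rootOn_infinite (m : ℤ) :
    totalSum Chain.infinite (Chain.infinite.rootOn m) = 0 ∧
      (pair (Chain.infinite.rootOn m) fun l => ((l : ℤ) : ℝ)) = -1 := by
  rw [totalSum_eq_pair, rootOn_infinite, pair_sub_left, pair_sub_left]
  simp

theorem FieldParams.generator_isSymmetry {P : FieldParams} {I J : Set ℝ} (hI : IsOpen I)
    (hJ : IsOpen J) (U : ℤ → Set ℝ) (hP : P.Smooth I J) : P.generator.IsSymmetry I J U :=
  FieldParams.on_isSymmetry hI hJ U hP fun m => Or.inr (by
    rw [(pair_rootOn_infinite m).1, (pair_rootOn_infinite m).2]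
    exact ⟨by ring, fun _ _ _ _ => by ring⟩)

theorem LatticeParams.generator_isSymmetry (P : LatticeParams) (I : Set ℝ) (U : ℤ → Set ℝ) :
    P.generator.IsSymmetry I U :=
  LatticeParams.on_isSymmetry I U fun m => Or.inr (by
    rw [(pair_rootOn_infinite m).1, (pair_rootOn_infinite m).2]
    exact ⟨by ring, by ring, by ring⟩)

variable {T : Series}

/-- The roots of a chain with a left end: the vanishing ones, the bonds, and the additional one. -/
lemma Chain.IsLeftEnded.rootOn_cases (hc : c.IsLeftEnded T) (m : ℤ) :
    c.rootOn m = 0 ∨ (totalSum c (c.rootOn m) = 0 ∧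
      (pair (c.rootOn m) fun l => ((l : ℤ) : ℝ)) = -1) ∨
    match T with
    | .A => False
    | .B => totalSum c (c.rootOn m) = -1 ∧ (pair (c.rootOn m) fun l => ((l : ℤ) : ℝ)) = -1
    | .C => totalSum c (c.rootOn m) = -2 ∧ (pair (c.rootOn m) fun l => ((l : ℤ) : ℝ)) = -2
    | .D => totalSum c (c.rootOn m) = -2 ∧ (pair (c.rootOn m) fun l => ((l : ℤ) : ℝ)) = -3 := by
  rw [totalSum_eq_pair]
  by_cases h0 : m = 0
  · subst h0
    rw [hc.pair_zero, hc.pair_zero, hc.rootOn_zero]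
    cases T with
    | A => exact Or.inl rfl
    | B => exact Or.inr (Or.inr (by norm_num))
    | C => exact Or.inr (Or.inr (by norm_num))
    | D => exact Or.inr (Or.inr (by norm_num))
  by_cases hm : 1 ≤ m ∧ m + 1 ∈ c.sites
  · rw [hc.pair_bond hm.1 hm.2, hc.pair_bond hm.1 hm.2]
    exact Or.inr (Or.inl (by simp))
  · exact Or.inl (hc.rootOn_other h0 hm)

theorem FieldParams.Survives.isSymmetry (hc : c.IsLeftEnded T) {P : FieldParams} {I J : Set ℝ}
    (hI : IsOpen I) (hJ : IsOpen J) (U : ℤ → Set ℝ) (hP : P.Smooth I J)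
    (hT : P.Survives I J T) : (P.on c).IsSymmetry I J U := by
  refine FieldParams.on_isSymmetry hI hJ U hP fun m => ?_
  rcases hc.rootOn_cases m with h | ⟨h1, h2⟩ | h
  · exact Or.inl h
  · rw [h1, h2]
    exact Or.inr ⟨by ring, fun _ _ _ _ => by ring⟩
  · right
    cases T with
    | A => exact h.elim
    | B =>
      rw [h.1, h.2, hT.1]
      exact ⟨by ring, fun x hx y hy => by rw [hT.2 x hx y hy]; ring⟩
    | C =>
      rw [h.1, h.2, hT.1]
      exact ⟨by ring, fun x hx y hy => by rw [hT.2 x hx y hy]; ring⟩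
    | D =>
      rw [h.1, h.2, hT.1]
      exact ⟨by ring, fun x hx y hy => by rw [hT.2 x hx y hy]; ring⟩

theorem LatticeParams.Survives.isSymmetry (hc : c.IsLeftEnded T) {P : LatticeParams} (I : Set ℝ)
    (U : ℤ → Set ℝ) (hT : P.Survives T) : (P.on c).IsSymmetry I U := by
  refine LatticeParams.on_isSymmetry I U fun m => ?_
  rcases hc.rootOn_cases m with h | ⟨h1, h2⟩ | h
  · exact Or.inl h
  · rw [h1, h2]
    exact Or.inr ⟨by ring, by ring, by ring⟩
  · right
    cases T with
    | A => exact h.elim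
    | B =>
      rw [h.1, h.2, hT.1, hT.2.1, hT.2.2]
      exact ⟨by ring, by ring, by ring⟩
    | C =>
      rw [h.1, h.2, hT.1, hT.2.1, hT.2.2]
      exact ⟨by ring, by ring, by ring⟩
    | D =>
      rw [h.1, h.2, hT.1, hT.2.1, hT.2.2]
      exact ⟨by ring, by ring, by ring⟩

/-! ### Comparison of chains with a left end -/

variable {I J : Set ℝ} {U : ℤ → Set ℝ}

/-- The constant parts and the coefficients of the sum of the fields are determined by the
generator. -/
lemma eq_of_add_totalSum_eq (hc : c.IsLeftEnded T) (hU : ∀ n, IsOpen (U n)) {u₀ : c.Config}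
    (hu₀ : c.InBox U u₀) {k k' b b' : ℝ}
    (h : ∀ u, c.InBox U u → k + b * totalSum c u = k' + b' * totalSum c u) : k = k' ∧ b = b' := by
  obtain ⟨s, hs0, hs⟩ := hu₀.exists_add_single hU ⟨1, hc.one_mem⟩
  have h1 := h _ hu₀
  have h2 := h _ hs
  have h3 : totalSum c (Finsupp.single ⟨1, hc.one_mem⟩ 1) = 1 := by simp [totalSum_apply]
  rw [map_add, map_smul, h3, smul_eq_mul, mul_one] at h2
  have h4 : s * (b - b') = 0 := by linarith
  have h5 := sub_eq_zero.1 ((mul_eq_zero.1 h4).resolve_left hs0)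
  subst h5
  exact ⟨by linarith, rfl⟩

/-- The difference of `φ` at the sites `1` and `2` is `ξ' + η'`, and varying one field inside the
open box separates `c` from `β + γ`. These quantities determine the field on any chain, although `β`
and `γ` separately are not determined. -/
lemma FieldParams.eqOn_of_eqOn {c' : Chain} (hc : c.IsLeftEnded T)
    (hU : ∀ n, IsOpen (U n)) (hne : ∃ u, c.InBox U u) {P Q : FieldParams}
    (h : (P.on c).EqOn I J U (Q.on c)) : (P.on c').EqOn I J U (Q.on c') := by
  obtain ⟨u₀, hu₀⟩ := hne
  intro x hx y hy u _
  have h0 := h x hx y hy u₀ hu₀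
  refine ⟨h0.1, h0.2.1, fun n => ?_⟩
  have h1 := h0.2.2 ⟨1, hc.one_mem⟩
  have h2 := h0.2.2 ⟨2, hc.two_mem⟩
  simp only [FieldParams.on] at h1 h2
  push_cast at h1 h2
  have hσ : deriv P.ξ x + deriv P.η y = deriv Q.ξ x + deriv Q.η y := by linarith
  obtain ⟨hk, hb⟩ := eq_of_add_totalSum_eq hc hU hu₀ (k := P.β x + P.γ y) (k' := Q.β x + Q.γ y)
    (b := P.c) (b' := Q.c) fun u hu => by
      have := (h x hx y hy u hu).2.2 ⟨1, hc.one_mem⟩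
      simp only [FieldParams.on, hσ] at this
      rw [totalSum_apply]
      linarith
  simp only [FieldParams.on, hσ, hk, hb]

lemma LatticeParams.eqOn_of_eqOn {c' : Chain} (hc : c.IsLeftEnded T)
    (hU : ∀ n, IsOpen (U n)) (hne : ∃ u, c.InBox U u) {P Q : LatticeParams}
    (h : (P.on c).EqOn I U (Q.on c)) : (P.on c').EqOn I U (Q.on c') := by
  obtain ⟨u₀, hu₀⟩ := hne
  intro t ht u _
  have h0 := h t ht u₀ hu₀
  refine ⟨h0.1, fun n => ?_⟩
  have h1 := h0.2 ⟨1, hc.one_mem⟩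
  have h2 := h0.2 ⟨2, hc.two_mem⟩
  simp only [LatticeParams.on] at h1 h2
  push_cast at h1 h2
  have hσ : P.d = Q.d := by linarith
  obtain ⟨hk, hb⟩ := eq_of_add_totalSum_eq hc hU hu₀ (k := P.a + P.b * t) (k' := Q.a + Q.b * t)
    (b := P.c) (b' := Q.c) fun u hu => by
      have := (h t ht u hu).2 ⟨1, hc.one_mem⟩
      simp only [LatticeParams.on, hσ] at this
      rw [totalSum_apply]
      linarith
  simp only [LatticeParams.on, hσ, hb]
  linarith

end Generators

end Toda

/-! ### Comparison of the infinite, semi-infinite and finite chains -/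

theorem theorem3 (T : Toda.Series) (N : ℕ) (hN : 2 ≤ N)
    (I J : Set ℝ) (U : ℤ → Set ℝ)
    (hI : Toda.IsOpenInterval I) (hJ : Toda.IsOpenInterval J)
    (hU : ∀ n, Toda.IsOpenInterval (U n))
    (hU0 : ∀ n : ℤ, n ∉ Set.Icc 1 (N : ℤ) → (0 : ℝ) ∈ U n) :
    -- field theories
    ((∀ P : Toda.FieldParams, P.Smooth I J → P.generator.IsSymmetry I J U) ∧
      (∀ v : Toda.FieldVF (Toda.Chain.finite T N), v.IsSymmetry I J U ↔
        ∃ P : Toda.FieldParams, P.Smooth I J ∧ P.Survives I J T ∧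
          v.EqOn I J U (P.generator.reduce (Toda.finite_subset_infinite T N))) ∧
      (∀ w : Toda.FieldVF (Toda.Chain.semiInfinite T), w.IsSymmetry I J U →
        (w.reduce (Toda.finite_subset_semiInfinite T N)).IsSymmetry I J U) ∧
      (∀ v : Toda.FieldVF (Toda.Chain.finite T N), v.IsSymmetry I J U →
        ∃ w : Toda.FieldVF (Toda.Chain.semiInfinite T), w.IsSymmetry I J U ∧
          v.EqOn I J U (w.reduce (Toda.finite_subset_semiInfinite T N))) ∧
      (∀ w w' : Toda.FieldVF (Toda.Chain.semiInfinite T),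
        w.IsSymmetry I J U → w'.IsSymmetry I J U →
        (w.reduce (Toda.finite_subset_semiInfinite T N)).EqOn I J U
          (w'.reduce (Toda.finite_subset_semiInfinite T N)) →
        w.EqOn I J U w')) ∧
    -- lattices
    ((∀ P : Toda.LatticeParams, P.generator.IsSymmetry I U) ∧
      (∀ v : Toda.LatticeVF (Toda.Chain.finite T N), v.IsSymmetry I U ↔
        ∃ P : Toda.LatticeParams, P.Survives T ∧
          v.EqOn I U (P.generator.reduce (Toda.finite_subset_infinite T N))) ∧
      (∀ w : Toda.LatticeVF (Toda.Chain.semiInfinite T), w.IsSymmetry I U →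
        (w.reduce (Toda.finite_subset_semiInfinite T N)).IsSymmetry I U) ∧
      (∀ v : Toda.LatticeVF (Toda.Chain.finite T N), v.IsSymmetry I U →
        ∃ w : Toda.LatticeVF (Toda.Chain.semiInfinite T), w.IsSymmetry I U ∧
          v.EqOn I U (w.reduce (Toda.finite_subset_semiInfinite T N))) ∧
      (∀ w w' : Toda.LatticeVF (Toda.Chain.semiInfinite T),
        w.IsSymmetry I U → w'.IsSymmetry I U →
        (w.reduce (Toda.finite_subset_semiInfinite T N)).EqOn I U
          (w'.reduce (Toda.finite_subset_semiInfinite T N)) →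
        w.EqOn I U w')) := by
  have hUo : ∀ n, IsOpen (U n) := fun n => (hU n).1
  have hcf := Toda.isLeftEnded_finite T hN
  have hcs := Toda.isLeftEnded_semiInfinite T
  have hnef : ∃ u, (Toda.Chain.finite T N).InBox U u :=
    Toda.exists_inBox (fun n => (hU n).2.2) hU0
  have hnes : ∃ u, (Toda.Chain.semiInfinite T).InBox U u :=
    Toda.exists_inBox (fun n => (hU n).2.2) hU0
  have hi := Toda.finite_subset_infinite T N
  have hs := Toda.finite_subset_semiInfinite T N
  refine ⟨⟨fun P hP => P.generator_isSymmetry hI.1 hJ.1 U hP, fun v => ⟨fun hv => ?_, ?_⟩,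
    fun w hw => ?_, fun v hv => ?_, fun w w' hw hw' h => ?_⟩,
    ⟨fun P => P.generator_isSymmetry I U, fun v => ⟨fun hv => ?_, ?_⟩,
    fun w hw => ?_, fun v hv => ?_, fun w w' hw hw' h => ?_⟩⟩
  · obtain ⟨P, hP, hT, h⟩ := hv.exists_params hcf hI hJ hU hnef
    exact ⟨P, hP, hT, by rwa [← P.on_reduce hi] at h⟩
  · rintro ⟨P, hP, hT, h⟩
    exact (hT.isSymmetry hcf hI.1 hJ.1 U hP).congr hI.1 hJ.1 hUo
      (by rwa [← P.on_reduce hi])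
  -- The conditions at the left end are the same for both chains. By `hU0`, extension by `0` stays
  -- inside the box, so the normal form can be reduced.
  · obtain ⟨P, hP, hT, h⟩ := hw.exists_params hcs hI hJ hU hnes
    have h' := h.reduce hs hU0
    rw [P.on_reduce] at h'
    exact (hT.isSymmetry hcf hI.1 hJ.1 U hP).congr hI.1 hJ.1 hUo h'
  · obtain ⟨P, hP, hT, h⟩ := hv.exists_params hcf hI hJ hU hnef
    exact ⟨P.on _, hT.isSymmetry hcs hI.1 hJ.1 U hP, by rwa [P.on_reduce]⟩
  -- Injectivity: both fields are put in normal form, and agreement on the finite chain carries over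
  -- to the semi-infinite one.
  · obtain ⟨P, -, -, hP⟩ := hw.exists_params hcs hI hJ hU hnes
    obtain ⟨Q, -, -, hQ⟩ := hw'.exists_params hcs hI hJ hU hnes
    have h1 := ((hP.reduce hs hU0).symm.trans h).trans (hQ.reduce hs hU0)
    rw [P.on_reduce, Q.on_reduce] at h1
    exact (hP.trans (Toda.FieldParams.eqOn_of_eqOn hcf hUo hnef h1)).trans hQ.symm
  · obtain ⟨P, hT, h⟩ := hv.exists_params hcf hI hU hnef
    exact ⟨P, hT, by rwa [← P.on_reduce hi] at h⟩
  · rintro ⟨P, hT, h⟩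
    exact (hT.isSymmetry hcf I U).congr hI.1 hUo (by rwa [← P.on_reduce hi])
  · obtain ⟨P, hT, h⟩ := hw.exists_params hcs hI hU hnes
    have h' := h.reduce hs hU0
    rw [P.on_reduce] at h'
    exact (hT.isSymmetry hcf I U).congr hI.1 hUo h'
  · obtain ⟨P, hT, h⟩ := hv.exists_params hcf hI hU hnef
    exact ⟨P.on _, hT.isSymmetry hcs I U, by rwa [P.on_reduce]⟩
  · obtain ⟨P, -, hP⟩ := hw.exists_params hcs hI hU hnes
    obtain ⟨Q, -, hQ⟩ := hw'.exists_params hcs hI hU hnes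
    have h1 := ((hP.reduce hs hU0).symm.trans h).trans (hQ.reduce hs hU0)
    rw [P.on_reduce, Q.on_reduce] at h1
    exact (hP.trans (Toda.LatticeParams.eqOn_of_eqOn hcf hUo hnef h1)).trans hQ.symm
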